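/- Let $d\ge 1$, let $u:\mathbb Z^d\to\mathbb R$ be summable and not identically zero, let $\mu$ be a probability measure on $\mathbb R$ with a density $\rho$ of finite total variation, whose total variation is denoted $\|\rho\|_{\rm BV}$, and let $(\omega_k)_{k\in\mathbb Z^d}$ be independent random variables with distribution $\mu$. For $\lambda>0$ let $$(H_\omega\psi)(x)=-\sum_{|e|_1=1}\psi(x+e)+\lambda V_\omega(x)\psi(x),\qquad V_\omega(x)=\sum_{k\in\mathbb Z^d}\omega_k u(x-k),\qquad x\in\mathbb Z^d ,$$ and let $H_{\omega,L}$ be the compression of $H_\omega$ to $\ell^2(\Lambda_L)$, where $\Lambda_L=\{k\in\mathbb Z^d:|k|_\infty\le L\}$. Let $\chi_I(H_{\omega,L})$ be the spectral projection of $H_{\omega,L}$ onto $I$. In each of the following estimates the random variable $\operatorname{Tr}\chi_{[E-\epsilon,E+\epsilon]}(H_{\omega,L})$ is integrable. (a) There is a constant $c_u>0$ depending only on $u$ such that, if $n\in\mathbb N_0$ and $u$ has support in $[0,n]^d\cap\mathbb Z^d$, then for all integers $L\ge1$, all $E\in\mathbb R$ and all $\epsilon,\lambda>0$ $$\mathbb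 E\{\operatorname{Tr}\chi_{[E-\epsilon,E+\epsilon]}(H_{\omega,L})\}\le \frac{c_u}{\lambda}\,|\operatorname{supp}u|\,\|\rho\|_{\rm BV}\,\epsilon\,(2L+n)^{d(n+1)} .$$ (b) Assume that $\bar u=\sum_{k}u(k)\ne0$, that $\rho$ has compact support, and that $m\in\mathbb N_0$ satisfies $\sum_{\|k\|_1\ge m}|u(k)|\le|\bar u/2|$. Then for all integers $L\ge1$, all $E\in\mathbb R$ and all $\epsilon,\lambda>0$ $$\mathbb E\{\operatorname{Tr}\chi_{[E-\epsilon,E+\epsilon]}(H_{\omega,L})\}\le \frac{8}{\lambda|\bar u|}\,\min\bigl((2L+1)^d,|\operatorname{supp}u|\bigr)\,\|\rho\|_{\rm BV}\,\epsilon\,(2L+m)^{d} ,$$ and if $L\ge d$, then $(2L+1)^d$ can be replaced by $(2L)^d$ in this bound. (c) Assume that there are $C,\alpha>0$ with $|u(k)|\le Ce^{-\alpha\|k\|_1}$ for all $k\in\mathbb Z^d$. Then there are $c_u>0$ and $I_0\in\mathbb N_0^d$, both depending only on $u$, such that, if $\rho$ has bounded support, then for all integers $L\ge1$, all $E\in\mathbb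 R$ and all $\epsilon,\lambda>0$ $$\mathbb E\{\operatorname{Tr}\chi_{[E-\epsilon,E+\epsilon]}(H_{\omega,L})\}\le \frac{c_u}{\lambda}\,\|\rho\|_{\rm BV}\,\epsilon\,(2L+1)^{2d+|I_0|},$$ where $|I_0|$ is the sum of the entries of $I_0$. -/

import Mathlib

open MeasureTheory

noncomputable section

namespace AlloyType

variable {d : ℕ}

/-- The `ℓ¹` norm on the lattice `ℤ^d`. -/
def l1norm (x : Fin d → ℤ) : ℤ := ∑ i, |x i|

/-- The cube `Λ_L = {k ∈ ℤ^d : |k|_∞ ≤ L}`, which has `(2L+1)^d` points. -/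
def cube (d L : ℕ) : Finset (Fin d → ℤ) :=
  Finset.Icc (fun _ => -(L : ℤ)) (fun _ => (L : ℤ))

/-- The lattice vectors `e` with `|e|_1 = 1` (their coordinates lie in `{-1, 0, 1}`). -/
def unitVectors (d : ℕ) : Finset (Fin d → ℤ) :=
  (Finset.Icc (fun _ => -1) (fun _ => 1)).filter (fun e => l1norm e = 1)

/-- The discrete Laplace operator `(Δψ)(x) = ∑_{|e|_1 = 1} ψ(x + e)`. -/
def laplace (ψ : (Fin d → ℤ) → ℂ) (x : Fin d → ℤ) : ℂ :=
  ∑ e ∈ unitVectors d, ψ (x + e)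

/-- The alloy-type potential `V_ω(x) = ∑_k ω_k u(x - k)`. -/
def potential (u ω : (Fin d → ℤ) → ℝ) (x : Fin d → ℤ) : ℝ :=
  ∑' k, ω k * u (x - k)

/-- The action of `H_ω = -Δ + lam V_ω` on functions on the lattice. -/
def hamiltonian (u : (Fin d → ℤ) → ℝ) (lam : ℝ) (ω : (Fin d → ℤ) → ℝ)
    (ψ : (Fin d → ℤ) → ℂ) (x : Fin d → ℤ) : ℂ :=
  -laplace ψ x + ((lam * potential u ω x : ℝ) : ℂ) * ψ x

/-- The restriction `H_{ω,L}` of `H_ω` to `ℓ²(Λ_L)`, that is, the compression of `H_ω` to the cube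
`Λ_L`, as a matrix in the basis `(δ_k)` of `ℓ²(Λ_L)`: the entry at `(x, y)` is `(H_ω δ_y)(x)`. -/
def restricted (u : (Fin d → ℤ) → ℝ) (lam : ℝ) (L : ℕ) (ω : (Fin d → ℤ) → ℝ) :
    Matrix (cube d L) (cube d L) ℂ :=
  Matrix.of fun x y => hamiltonian u lam ω (Pi.single (y : Fin d → ℤ) 1) x

/-- `Tr χ_I(H_{ω,L})`, where `χ_I(H_{ω,L})` is the spectral projection given by the functional
calculus of the Hermitian matrix `H_{ω,L}`. -/
def spectralTrace (u : (Fin d → ℤ) → ℝ) (lam : ℝ) (L : ℕ) (I : Set ℝ)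
    (ω : (Fin d → ℤ) → ℝ) : ℝ :=
  (cfc (I.indicator (fun _ => (1 : ℝ))) (restricted u lam L ω)).trace.re

/-- The law of independent coupling constants `(ω_k)`, each with distribution `μ`. -/
def couplingLaw (d : ℕ) (μ : Measure ℝ) [IsProbabilityMeasure μ] :
    Measure ((Fin d → ℤ) → ℝ) :=
  Measure.infinitePi fun _ => μ

/-- `ρ` is a density of `μ`, of finite total variation. -/
structure IsBVDensity (μ : Measure ℝ) (ρ : ℝ → ℝ) : Prop where
  nonneg : ∀ x, 0 ≤ ρ x
  measurable : Measurable ρ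
  boundedVariation : BoundedVariationOn ρ Set.univ
  eq_withDensity : μ = volume.withDensity (fun x => ENNReal.ofReal (ρ x))

/-- The total variation `‖ρ‖_BV`. -/
def bvNorm (ρ : ℝ → ℝ) : ℝ := (eVariationOn ρ Set.univ).toReal

/-- The Wegner bound `E{Tr χ_{[E-ε,E+ε]}(H_{ω,L})} ≤ K`. Integrability is part of the claim. -/
def WegnerBound (u : (Fin d → ℤ) → ℝ) (lam : ℝ) (μ : Measure ℝ) [IsProbabilityMeasure μ]
    (L : ℕ) (E ε K : ℝ) : Prop :=
  Integrable (spectralTrace u lam L (Set.Icc (E - ε) (E + ε))) (couplingLaw d μ) ∧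
    ∫ ω, spectralTrace u lam L (Set.Icc (E - ε) (E + ε)) ω ∂(couplingLaw d μ) ≤ K

/-- `min(M, |supp u|)`, with `|supp u| = ∞` allowed. -/
def minSupp (u : (Fin d → ℤ) → ℝ) (M : ℕ) : ℕ :=
  (min (M : ℕ∞) (Function.support u).encard).toNat

/-- `H_{ω,L}` is Hermitian, so that its functional calculus is not a default value. -/
theorem restricted_isHermitian (u : (Fin d → ℤ) → ℝ) (lam : ℝ) (L : ℕ)
    (ω : (Fin d → ℤ) → ℝ) : (restricted u lam L ω).IsHermitian := by
  have key : ∀ x y : Fin d → ℤ,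
      laplace (Pi.single y (1 : ℂ)) x = if y - x ∈ unitVectors d then 1 else 0 := by
    intro x y
    simp only [laplace, Pi.single_apply]
    simp_rw [show ∀ e, (x + e = y) ↔ (e = y - x) from
      fun e => ⟨fun h => by simp [← h], fun h => by simp [h]⟩]
    rw [Finset.sum_ite_eq']
  have hsym : ∀ z : Fin d → ℤ, z ∈ unitVectors d ↔ -z ∈ unitVectors d := by
    intro z
    have hn : l1norm (-z) = l1norm z := by simp [l1norm]
    simp only [unitVectors, Finset.mem_filter, Finset.mem_Icc, hn, Pi.le_def, Pi.neg_apply]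
    constructor
    · rintro ⟨⟨h1, h2⟩, h3⟩
      exact ⟨⟨fun i => by linarith [h2 i], fun i => by linarith [h1 i]⟩, h3⟩
    · rintro ⟨⟨h1, h2⟩, h3⟩
      exact ⟨⟨fun i => by linarith [h2 i], fun i => by linarith [h1 i]⟩, h3⟩
  refine Matrix.IsHermitian.ext fun x y => ?_
  have h := hsym ((x : Fin d → ℤ) - y)
  rw [neg_sub] at h
  simp only [restricted, Matrix.of_apply, hamiltonian, key, Pi.single_apply, h]
  by_cases hxy : (x : Fin d → ℤ) = y
  · simp [hxy, Complex.conj_ofReal]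
  · simp [hxy, Ne.symm hxy, apply_ite]

end AlloyType

end

/-!
Changing finitely many coupling constants is a perturbation whose rank is the number of box sites
in the support of the corresponding translates of `u`, so it moves the eigenvalue counting function
by at most that rank; averaging a function with oscillation `r` over a shift `t` of a variable with
density `ρ` therefore costs at most `r |t| ‖ρ‖_BV / 2`. On the other hand, shifting `ω` along
finitely supported coefficients `a` whose convolution with `u` is at least `δ` on the box raises
the spectrum by `λ t δ`. Comparing the two effects bounds the expected number of eigenvalues in an
interval by its length times `r ‖ρ‖_BV ∑ |a k| / (λ δ)`.

It remains to choose `a`. If `∑ u k ≠ 0`, the indicator of a neighbourhood of the box works. In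
general take the monomial `a k = k ^ I` for a minimal `I` with `∑ k ^ I u k ≠ 0`: expanding
`(x - k) ^ I`, all lower moments drop out, so the convolution is the constant
`(-1) ^ |I| ∑ k ^ I u k`, up to the error of truncating `a` to a large cube. Some moment is nonzero
since an exponentially decaying `u` is the difference of two finite measures with exponential
moments, and such measures are determined by their moments: the complex moment generating function
of each of their one-dimensional projections is analytic in a strip around the imaginary axis.
-/

noncomputable section

namespace AlloyType

variable {d : ℕ}

section EigenvalueMeasure

open scoped InnerProductSpace Topology

variable {𝕜 X : Type*} [RCLike 𝕜] [Fintype X] [DecidableEq X] {A B : Matrix X X 𝕜} {E E' : ℝ}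

/-- The eigenvalue counting measure of a Hermitian matrix: the sum of the point masses at its
eigenvalues, repeated according to multiplicity. -/
def eigenvalueMeasure (hA : A.IsHermitian) : Measure ℝ :=
  ∑ i, Measure.dirac (hA.eigenvalues i)

instance (hA : A.IsHermitian) : IsFiniteMeasure (eigenvalueMeasure hA) := by
  unfold eigenvalueMeasure
  infer_instance

theorem eigenvalueMeasure_real_apply (hA : A.IsHermitian) {s : Set ℝ} (hs : MeasurableSet s) :
    (eigenvalueMeasure hA).real s = ∑ i, s.indicator 1 (hA.eigenvalues i) := by
  rw [eigenvalueMeasure, measureReal_def, Measure.finsetSum_apply,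
    ENNReal.toReal_sum fun i _ => measure_ne_top _ _]
  refine Finset.sum_congr rfl fun i _ => ?_
  rw [Measure.dirac_apply' _ hs]
  by_cases hi : hA.eigenvalues i ∈ s <;> simp [hi]

theorem eigenvalueMeasure_univ (hA : A.IsHermitian) :
    eigenvalueMeasure hA Set.univ = Fintype.card X := by
  simp [eigenvalueMeasure]

theorem eigenvalueMeasure_real_le_card (hA : A.IsHermitian) (s : Set ℝ) :
    (eigenvalueMeasure hA).real s ≤ Fintype.card X := by
  simpa [measureReal_def, eigenvalueMeasure_univ hA] using
    measureReal_mono (μ := eigenvalueMeasure hA) (Set.subset_univ s)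

theorem eigenvalueMeasure_real_Iic (hA : A.IsHermitian) (E : ℝ) :
    (eigenvalueMeasure hA).real (Set.Iic E) = Fintype.card {i // hA.eigenvalues i ≤ E} := by
  rw [eigenvalueMeasure_real_apply hA measurableSet_Iic, Fintype.card_subtype, Finset.card_filter]
  push_cast
  exact Finset.sum_congr rfl fun i _ => by simp [Set.indicator_apply]

theorem trace_cfc_indicator (hA : A.IsHermitian) {s : Set ℝ} (hs : MeasurableSet s) :
    (cfc (s.indicator fun _ => (1 : ℝ)) A).trace = ((eigenvalueMeasure hA).real s : 𝕜) := by
  rw [hA.cfc_eq, Matrix.IsHermitian.cfc, Unitary.conjStarAlgAut_apply, Matrix.trace_mul_cycle,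
    Unitary.coe_star_mul_self, one_mul, Matrix.trace_diagonal, eigenvalueMeasure_real_apply hA hs]
  push_cast
  rfl

theorem reApplyInnerSelf_eq_sum_eigenvalues_mul (hA : A.IsHermitian) (x : EuclideanSpace 𝕜 X) :
    (Matrix.toEuclideanCLM (𝕜 := 𝕜) A).reApplyInnerSelf x =
      ∑ i, hA.eigenvalues i * ‖⟪hA.eigenvectorBasis i, x⟫_𝕜‖ ^ 2 := by
  have hsymm := Matrix.isSymmetric_toEuclideanLin_iff.2 hA
  have happly (i : X) : Matrix.toEuclideanLin A (hA.eigenvectorBasis i) =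
      (hA.eigenvalues i : 𝕜) • hA.eigenvectorBasis i := by
    ext j
    simpa [RCLike.real_smul_eq_coe_mul] using congrFun (hA.mulVec_eigenvectorBasis i) j
  rw [← Matrix.coe_toEuclideanCLM_eq_toEuclideanLin] at hsymm happly
  rw [ContinuousLinearMap.reApplyInnerSelf_apply,
    ← hA.eigenvectorBasis.sum_inner_mul_inner, map_sum]
  refine Finset.sum_congr rfl fun i _ => ?_
  calc RCLike.re (⟪Matrix.toEuclideanCLM (𝕜 := 𝕜) A x, hA.eigenvectorBasis i⟫_𝕜 *
        ⟪hA.eigenvectorBasis i, x⟫_𝕜)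
      = RCLike.re ((hA.eigenvalues i : 𝕜) *
          (⟪x, hA.eigenvectorBasis i⟫_𝕜 * ⟪hA.eigenvectorBasis i, x⟫_𝕜)) := by
        rw [← mul_assoc, ← inner_smul_right (𝕜 := 𝕜) x, ← happly i]
        exact congrArg (fun z => RCLike.re (z * _)) (hsymm x _)
    _ = hA.eigenvalues i * ‖⟪hA.eigenvectorBasis i, x⟫_𝕜‖ ^ 2 := by
        rw [RCLike.re_ofReal_mul, inner_mul_symm_re_eq_norm, norm_mul, norm_inner_symm, sq]

theorem reApplyInnerSelf_le_of_inner_eq_zero (hA : A.IsHermitian) {x : EuclideanSpace 𝕜 X}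
    (hx : ∀ i, E < hA.eigenvalues i → ⟪hA.eigenvectorBasis i, x⟫_𝕜 = 0) :
    (Matrix.toEuclideanCLM (𝕜 := 𝕜) A).reApplyInnerSelf x ≤ E * ‖x‖ ^ 2 := by
  rw [reApplyInnerSelf_eq_sum_eigenvalues_mul hA, ← hA.eigenvectorBasis.sum_sq_norm_inner_right x,
    Finset.mul_sum]
  refine Finset.sum_le_sum fun i _ => ?_
  rcases lt_or_ge E (hA.eigenvalues i) with hi | hi
  · simp [hx i hi]
  · gcongr

theorem lt_reApplyInnerSelf_of_inner_eq_zero (hA : A.IsHermitian) {x : EuclideanSpace 𝕜 X}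
    (hx0 : x ≠ 0) (hx : ∀ i, hA.eigenvalues i ≤ E → ⟪hA.eigenvectorBasis i, x⟫_𝕜 = 0) :
    E * ‖x‖ ^ 2 < (Matrix.toEuclideanCLM (𝕜 := 𝕜) A).reApplyInnerSelf x := by
  obtain ⟨j, hj⟩ : ∃ j, ⟪hA.eigenvectorBasis j, x⟫_𝕜 ≠ 0 := by
    by_contra! hzero
    exact hx0 (hA.eigenvectorBasis.repr.map_eq_zero_iff.1 (by
      ext i
      simpa [OrthonormalBasis.repr_apply_apply] using hzero i))
  rw [reApplyInnerSelf_eq_sum_eigenvalues_mul hA, ← hA.eigenvectorBasis.sum_sq_norm_inner_right x,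
    Finset.mul_sum]
  refine Finset.sum_lt_sum (fun i _ => ?_) ⟨j, Finset.mem_univ j, ?_⟩
  · rcases le_or_gt (hA.eigenvalues i) E with hi | hi
    · simp [hx i hi]
    · gcongr
  · have hlt : E < hA.eigenvalues j := not_le.1 fun hle => hj (hx j hle)
    gcongr

theorem card_eigenvalues_le_finrank (hA : A.IsHermitian) {F : Type*} [AddCommGroup F]
    [Module 𝕜 F] [Module.Finite 𝕜 F] (T : EuclideanSpace 𝕜 X →ₗ[𝕜] F)
    (hT : ∀ x, x ≠ 0 → T x = 0 →
      E * ‖x‖ ^ 2 < (Matrix.toEuclideanCLM (𝕜 := 𝕜) A).reApplyInnerSelf x) :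
    Fintype.card {i // hA.eigenvalues i ≤ E} ≤ Module.finrank 𝕜 F := by
  let v : {i // hA.eigenvalues i ≤ E} → EuclideanSpace 𝕜 X := fun i => hA.eigenvectorBasis i
  have hv : Function.Injective (Fintype.linearCombination 𝕜 v) :=
    linearIndependent_iff_injective_fintypeLinearCombination.1
      (hA.eigenvectorBasis.orthonormal.comp _ Subtype.val_injective).linearIndependent
  have hinj : Function.Injective (T ∘ₗ Fintype.linearCombination 𝕜 v) := by
    refine (injective_iff_map_eq_zero _).2 fun c hc => ?_
    by_contra hc0
    refine (hT _ (fun h => hc0 (hv (h.trans (map_zero _).symm))) hc).not_ge ?_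
    refine reApplyInnerSelf_le_of_inner_eq_zero hA fun i hi => ?_
    rw [Fintype.linearCombination_apply, inner_sum]
    refine Finset.sum_eq_zero fun j _ => ?_
    have hij : i ≠ j := fun h => (h ▸ j.2).not_gt hi
    rw [inner_smul_right, hA.eigenvectorBasis.orthonormal.2 hij, mul_zero]
  simpa using LinearMap.finrank_le_finrank_of_injective hinj

theorem eigenvalueMeasure_real_Iic_le_add_card (hA : A.IsHermitian) (hB : B.IsHermitian)
    (D : Finset X)
    (h : ∀ x : EuclideanSpace 𝕜 X, (∀ p ∈ D, x p = 0) →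
      (Matrix.toEuclideanCLM (𝕜 := 𝕜) (B - A)).reApplyInnerSelf x ≤ (E' - E) * ‖x‖ ^ 2) :
    (eigenvalueMeasure hA).real (Set.Iic E) ≤
      (eigenvalueMeasure hB).real (Set.Iic E') + D.card := by
  let T : EuclideanSpace 𝕜 X →ₗ[𝕜] ({i // hB.eigenvalues i ≤ E'} → 𝕜) × (D → 𝕜) :=
    (LinearMap.pi fun i : {i // hB.eigenvalues i ≤ E'} =>
      (innerSL 𝕜 (hB.eigenvectorBasis i)).toLinearMap).prod
    (LinearMap.pi fun p : D => (EuclideanSpace.proj (p : X)).toLinearMap)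
  have hcard := card_eigenvalues_le_finrank hA T (E := E) fun x hx0 hTx => by
    have hlow (i : X) (hi : hB.eigenvalues i ≤ E') : ⟪hB.eigenvectorBasis i, x⟫_𝕜 = 0 :=
      congrFun (congrArg Prod.fst hTx) ⟨i, hi⟩
    have hD (p : X) (hp : p ∈ D) : x p = 0 := congrFun (congrArg Prod.snd hTx) ⟨p, hp⟩
    have hBA := h x hD
    simp only [ContinuousLinearMap.reApplyInnerSelf_apply, map_sub, sub_apply,
      inner_sub_left] at hBA
    have hB' := lt_reApplyInnerSelf_of_inner_eq_zero hB hx0 hlow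
    rw [ContinuousLinearMap.reApplyInnerSelf_apply] at hB' ⊢
    linarith
  rw [Module.finrank_prod, Module.finrank_fintype_fun_eq_card,
    Module.finrank_fintype_fun_eq_card, Fintype.card_coe] at hcard
  rw [eigenvalueMeasure_real_Iic, eigenvalueMeasure_real_Iic]
  exact_mod_cast hcard

theorem reApplyInnerSelf_diagonal (w : X → ℝ) (x : EuclideanSpace 𝕜 X) :
    (Matrix.toEuclideanCLM (𝕜 := 𝕜) (Matrix.diagonal fun p => (w p : 𝕜))).reApplyInnerSelf x =
      ∑ p, w p * ‖x p‖ ^ 2 := by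
  rw [ContinuousLinearMap.reApplyInnerSelf_apply, PiLp.inner_apply, map_sum]
  refine Finset.sum_congr rfl fun p _ => ?_
  rw [Matrix.ofLp_toEuclideanCLM, Matrix.mulVec_diagonal, ← smul_eq_mul, inner_smul_left,
    RCLike.conj_ofReal, RCLike.re_ofReal_mul, inner_self_eq_norm_sq]

theorem eigenvalueMeasure_real_Iic_le_of_sub_eq_diagonal (hA : A.IsHermitian)
    (hB : B.IsHermitian) {w : X → ℝ} (hBA : B - A = Matrix.diagonal fun p => (w p : 𝕜))
    (D : Finset X) (hw : ∀ p ∉ D, w p ≤ E' - E) :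
    (eigenvalueMeasure hA).real (Set.Iic E) ≤
      (eigenvalueMeasure hB).real (Set.Iic E') + D.card := by
  refine eigenvalueMeasure_real_Iic_le_add_card hA hB D fun x hx => ?_
  rw [hBA, reApplyInnerSelf_diagonal, EuclideanSpace.norm_sq_eq, Finset.mul_sum]
  refine Finset.sum_le_sum fun p _ => ?_
  by_cases hp : p ∈ D
  · simp [hx p hp]
  · exact mul_le_mul_of_nonneg_right (hw p hp) (sq_nonneg _)

theorem eigenvalueMeasure_real_Iic_le_of_norm_sub_le (hA : A.IsHermitian) (hB : B.IsHermitian)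
    (h : ‖Matrix.toEuclideanCLM (𝕜 := 𝕜) (B - A)‖ ≤ E' - E) :
    (eigenvalueMeasure hA).real (Set.Iic E) ≤ (eigenvalueMeasure hB).real (Set.Iic E') := by
  simpa using eigenvalueMeasure_real_Iic_le_add_card hA hB ∅ fun x _ =>
    calc (Matrix.toEuclideanCLM (𝕜 := 𝕜) (B - A)).reApplyInnerSelf x
        ≤ ‖Matrix.toEuclideanCLM (𝕜 := 𝕜) (B - A) x‖ * ‖x‖ :=
          (RCLike.re_le_norm _).trans (norm_inner_le_norm _ _)
      _ ≤ (E' - E) * ‖x‖ * ‖x‖ := by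
          gcongr
          exact (ContinuousLinearMap.le_opNorm _ x).trans (by gcongr)
      _ = (E' - E) * ‖x‖ ^ 2 := by ring

theorem tendsto_measureReal_Iic_nhdsGT (μ : Measure ℝ) [IsFiniteMeasure μ] (E : ℝ) :
    Filter.Tendsto (fun E' => μ.real (Set.Iic E')) (𝓝[>] E) (𝓝 (μ.real (Set.Iic E))) := by
  have hlim := tendsto_measure_biInter_gt (μ := μ) (s := Set.Iic) (a := E)
    (fun _ _ => measurableSet_Iic.nullMeasurableSet) (fun _ _ _ h => Set.Iic_subset_Iic.2 h)
    ⟨E + 1, by simp, measure_ne_top _ _⟩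
  have hInter : ⋂ r > E, Set.Iic r = Set.Iic E := by
    ext x
    simpa using ⟨le_of_forall_gt_imp_ge_of_dense, fun h r hr => h.trans hr.le⟩
  rw [hInter] at hlim
  exact (ENNReal.tendsto_toReal (measure_ne_top _ _)).comp hlim

theorem upperSemicontinuous_eigenvalueMeasure_Iic (E : ℝ) :
    UpperSemicontinuous fun M : {M : Matrix X X 𝕜 // M.IsHermitian} =>
      (eigenvalueMeasure M.2).real (Set.Iic E) := by
  intro M y hy
  obtain ⟨E', hE', hlt⟩ : ∃ E' > E, (eigenvalueMeasure M.2).real (Set.Iic E') < y := by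
    have hright := (tendsto_measureReal_Iic_nhdsGT (eigenvalueMeasure M.2) E).eventually_lt_const hy
    exact (hright.and self_mem_nhdsWithin).exists.imp fun _ h => h.symm
  have hcont : Continuous fun N : {M : Matrix X X 𝕜 // M.IsHermitian} =>
      ‖Matrix.toEuclideanCLM (𝕜 := 𝕜) (M.1 - N.1)‖ :=
    (Matrix.toEuclideanCLM (𝕜 := 𝕜) (n := X)).toAlgEquiv.toLinearMap.continuous_of_finiteDimensional
      |>.comp (continuous_const.sub continuous_subtype_val) |>.norm
  filter_upwards [hcont.continuousAt.eventually_lt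
    (continuousAt_const (y := E' - E)) (by simpa using hE')] with N hN
  exact (eigenvalueMeasure_real_Iic_le_of_norm_sub_le N.2 M.2 hN.le).trans_lt hlt

theorem measurable_eigenvalueMeasure {Ω : Type*} [MeasurableSpace Ω] {H : Ω → Matrix X X 𝕜}
    (hH : ∀ ω, (H ω).IsHermitian) (hmeas : ∀ i j, Measurable fun ω => H ω i j) :
    Measurable fun ω => eigenvalueMeasure (hH ω) := by
  let _ : MeasurableSpace (Matrix X X 𝕜) := MeasurableSpace.pi
  have _ : BorelSpace (Matrix X X 𝕜) := Pi.borelSpace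
  have hval : Measurable fun ω => (⟨H ω, hH ω⟩ : {M : Matrix X X 𝕜 // M.IsHermitian}) :=
    (measurable_pi_lambda _ fun i => measurable_pi_lambda _ fun j => hmeas i j).subtype_mk
  refine Measurable.measure_of_isPiSystem
    (BorelSpace.measurable_eq.trans (borel_eq_generateFrom_Iic ℝ)) isPiSystem_Iic ?_ ?_
  · rintro _ ⟨E, rfl⟩
    convert ((upperSemicontinuous_eigenvalueMeasure_Iic E).measurable.comp hval).ennreal_ofReal
      using 2 with ω
    exact (ofReal_measureReal (measure_ne_top _ _)).symm
  · simp only [eigenvalueMeasure_univ, measurable_const]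

end EigenvalueMeasure

section Variation

open Set

theorem tsum_edist_int_le {α : Type*} [PseudoEMetricSpace α] (f : ℝ → α) {h : ℝ} (hh : 0 < h)
    (x : ℝ) :
    ∑' n : ℤ, edist (f (n • h + x)) (f (n • h + x - h)) ≤ eVariationOn f univ := by
  rw [ENNReal.tsum_eq_iSup_sum]
  refine iSup_le fun s => ?_
  obtain ⟨N, hN⟩ : ∃ N : ℕ, ∀ n ∈ s, -(N : ℤ) ≤ n ∧ n < N := by
    refine ⟨s.sup (fun n => n.natAbs + 1), fun n hn => ?_⟩
    have := Finset.le_sup (f := fun n : ℤ => n.natAbs + 1) hn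
    omega
  have hmono : Monotone fun i : ℕ => ((i : ℤ) - N) • h + x - h := fun i j hij => by
    simp only
    gcongr
  calc ∑ n ∈ s, edist (f (n • h + x)) (f (n • h + x - h))
      ≤ ∑ n ∈ (Finset.range (2 * N)).image (fun i : ℕ => (i : ℤ) - N),
          edist (f (n • h + x)) (f (n • h + x - h)) := by
        refine Finset.sum_le_sum_of_subset fun n hn => ?_
        have := hN n hn
        exact Finset.mem_image.2 ⟨(n + N).toNat, by simp; omega, by omega⟩
    _ = ∑ i ∈ Finset.range (2 * N), edist (f (((i : ℤ) - N) • h + x))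
          (f (((i : ℤ) - N) • h + x - h)) :=
        Finset.sum_image fun i _ j _ hij => by simpa using hij
    _ = ∑ i ∈ Finset.range (2 * N), edist (f ((((i + 1 : ℕ) : ℤ) - N) • h + x - h))
          (f (((i : ℤ) - N) • h + x - h)) := by
        refine Finset.sum_congr rfl fun i _ => ?_
        congr 2
        push_cast [zsmul_eq_mul]
        ring
    _ ≤ eVariationOn f univ := eVariationOn.sum_le hmono fun _ => mem_univ _

theorem lintegral_edist_shift_le {α : Type*} [PseudoEMetricSpace α] [MeasurableSpace α]
    [OpensMeasurableSpace α] [SecondCountableTopology α] {f : ℝ → α} (hf : Measurable f) {h : ℝ}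
    (hh : 0 < h) :
    ∫⁻ x, edist (f x) (f (x - h)) ≤ ENNReal.ofReal h * eVariationOn f univ := by
  have hmeas : Measurable fun x => edist (f x) (f (x - h)) :=
    hf.edist (hf.comp (measurable_id.sub_const h))
  let e : ℤ ≃ AddSubgroup.zmultiples h :=
    Equiv.ofInjective (fun n : ℤ => n • h) (zsmul_left_strictMono hh).injective
  calc ∫⁻ x, edist (f x) (f (x - h))
      = ∑' n : ℤ, ∫⁻ x in Ioc 0 (0 + h), edist (f (n • h + x)) (f (n • h + x - h)) := by
        rw [(isAddFundamentalDomain_Ioc hh 0 volume).lintegral_eq_tsum''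
          fun x => edist (f x) (f (x - h)), ← e.tsum_eq]
        rfl
    _ = ∫⁻ x in Ioc 0 (0 + h), ∑' n : ℤ, edist (f (n • h + x)) (f (n • h + x - h)) :=
        (lintegral_tsum fun n : ℤ => (hmeas.comp (measurable_const_add (n • h))).aemeasurable).symm
    _ ≤ ∫⁻ _ in Ioc 0 (0 + h), eVariationOn f univ := lintegral_mono (tsum_edist_int_le f hh)
    _ = ENNReal.ofReal h * eVariationOn f univ := by
        rw [setLIntegral_const, Real.volume_Ioc, mul_comm, zero_add, sub_zero]

theorem integral_abs_sub_shift_le {f : ℝ → ℝ} (hf : Measurable f)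
    (hbv : BoundedVariationOn f univ) (h : ℝ) :
    ∫ x, |f x - f (x - h)| ≤ |h| * bvNorm f := by
  wlog hh : 0 < h generalizing h
  · rcases (not_lt.1 hh).eq_or_lt with rfl | hneg
    · simp
    · rw [← abs_neg, ← integral_add_right_eq_self _ h]
      simpa [abs_sub_comm] using this (-h) (neg_pos.2 hneg)
  calc ∫ x, |f x - f (x - h)| = (∫⁻ x, edist (f x) (f (x - h))).toReal := by
        simp only [← Real.dist_eq, edist_dist]
        exact integral_eq_lintegral_of_nonneg_ae (ae_of_all _ fun _ => dist_nonneg)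
          (hf.dist (hf.comp (measurable_id.sub_const h))).aestronglyMeasurable
    _ ≤ (ENNReal.ofReal h * eVariationOn f univ).toReal :=
        ENNReal.toReal_mono (ENNReal.mul_ne_top ENNReal.ofReal_ne_top hbv)
          (lintegral_edist_shift_le hf hh)
    _ = |h| * bvNorm f := by
        rw [ENNReal.toReal_mul, ENNReal.toReal_ofReal hh.le, abs_of_pos hh, bvNorm]

theorem exists_forall_abs_sub_le_half {Ω : Type*} {F : Ω → ℝ} {r : ℝ}
    (hr : ∀ s t, F s - F t ≤ r) : ∃ c, ∀ s, |F s - c| ≤ r / 2 := by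
  refine ⟨(⨅ s, F s) + r / 2, fun s => ?_⟩
  have : Nonempty Ω := ⟨s⟩
  have hbdd : BddBelow (range F) := ⟨F s - r, forall_mem_range.2 fun t => by linarith [hr s t]⟩
  have hle : (⨅ t, F t) ≤ F s := ciInf_le hbdd s
  have hge : F s - r ≤ ⨅ t, F t := le_ciInf fun t => by linarith [hr s t]
  exact abs_le.2 ⟨by linarith, by linarith⟩

theorem integral_mul_le_of_integral_eq_zero {Ω : Type*} [MeasurableSpace Ω] {ν : Measure Ω}
    {g F : Ω → ℝ} (hg : Integrable g ν) (hg0 : ∫ s, g s ∂ν = 0) (hF : AEStronglyMeasurable F ν)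
    {r : ℝ} (hr : ∀ s t, F s - F t ≤ r) :
    ∫ s, g s * F s ∂ν ≤ r / 2 * ∫ s, |g s| ∂ν := by
  obtain ⟨c, hc⟩ := exists_forall_abs_sub_le_half hr
  have hint : Integrable (fun s => g s * (F s - c)) ν :=
    hg.mul_bdd (hF.sub aestronglyMeasurable_const) (ae_of_all _ hc)
  calc ∫ s, g s * F s ∂ν = ∫ s, (g s * (F s - c) + g s * c) ∂ν := by
        congr with s
        ring
    _ = ∫ s, g s * (F s - c) ∂ν := by
        rw [integral_add hint (hg.mul_const c), integral_mul_const, hg0, zero_mul, add_zero]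
    _ ≤ ∫ s, r / 2 * |g s| ∂ν := by
        refine integral_mono hint (hg.abs.const_mul _) fun s => ?_
        calc g s * (F s - c) ≤ |g s| * |F s - c| := (le_abs_self _).trans (abs_mul _ _).le
          _ ≤ r / 2 * |g s| := by
              rw [mul_comm]
              exact mul_le_mul_of_nonneg_right (hc s) (abs_nonneg _)
    _ = r / 2 * ∫ s, |g s| ∂ν := integral_const_mul _ _

theorem IsBVDensity.integrable {μ : Measure ℝ} [IsFiniteMeasure μ] {ρ : ℝ → ℝ}
    (hρ : IsBVDensity μ ρ) : Integrable ρ := by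
  refine ⟨hρ.measurable.aestronglyMeasurable, ?_⟩
  rw [hasFiniteIntegral_iff_ofReal (ae_of_all _ hρ.nonneg), ← setLIntegral_univ,
    ← withDensity_apply _ MeasurableSet.univ, ← hρ.eq_withDensity]
  exact measure_lt_top μ univ

theorem IsBVDensity.integral_eq {μ : Measure ℝ} {ρ : ℝ → ℝ} (hρ : IsBVDensity μ ρ) (F : ℝ → ℝ) :
    ∫ s, F s ∂μ = ∫ s, ρ s * F s := by
  rw [hρ.eq_withDensity, integral_withDensity_eq_integral_toReal_smul
    hρ.measurable.ennreal_ofReal (ae_of_all _ fun _ => ENNReal.ofReal_lt_top)]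
  simp only [ENNReal.toReal_ofReal (hρ.nonneg _), smul_eq_mul]

theorem IsBVDensity.ae_mem_support {μ : Measure ℝ} {ρ : ℝ → ℝ} (hρ : IsBVDensity μ ρ) :
    ∀ᵐ s ∂μ, s ∈ Function.support ρ := by
  rw [hρ.eq_withDensity, ae_withDensity_iff hρ.measurable.ennreal_ofReal]
  exact ae_of_all _ fun s hs h => hs (by simp [h])

theorem IsBVDensity.integral_sub_shift_le {μ : Measure ℝ} [IsFiniteMeasure μ] {ρ : ℝ → ℝ}
    (hρ : IsBVDensity μ ρ) {F : ℝ → ℝ} (hF : Measurable F) {r : ℝ}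
    (hr : ∀ s t, F s - F t ≤ r) (h : ℝ) :
    ∫ s, F s ∂μ - ∫ s, F (s + h) ∂μ ≤ r / 2 * |h| * bvNorm ρ := by
  have hbdd : ∀ s, ‖F s‖ ≤ |F 0| + r := fun s => by
    rw [Real.norm_eq_abs, abs_le]
    constructor <;> linarith [hr s 0, hr 0 s, neg_abs_le (F 0), le_abs_self (F 0)]
  have hint := hρ.integrable.mul_bdd hF.aestronglyMeasurable (ae_of_all _ hbdd)
  have hint_shift := (hρ.integrable.comp_sub_right h).mul_bdd hF.aestronglyMeasurable
    (ae_of_all _ hbdd)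
  have hmean : ∫ s, (ρ s - ρ (s - h)) = 0 := by
    rw [integral_sub hρ.integrable (hρ.integrable.comp_sub_right h),
      integral_sub_right_eq_self, sub_self]
  have hr0 : 0 ≤ r := by simpa using hr 0 0
  calc ∫ s, F s ∂μ - ∫ s, F (s + h) ∂μ
      = ∫ s, (ρ s - ρ (s - h)) * F s := by
        rw [hρ.integral_eq, hρ.integral_eq,
          ← integral_sub_right_eq_self (fun s => ρ s * F (s + h)) h]
        simp only [sub_add_cancel, sub_mul]
        rw [integral_sub hint hint_shift]
    _ ≤ r / 2 * ∫ s, |ρ s - ρ (s - h)| :=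
        integral_mul_le_of_integral_eq_zero
          (hρ.integrable.sub (hρ.integrable.comp_sub_right h)) hmean hF.aestronglyMeasurable hr
    _ ≤ r / 2 * (|h| * bvNorm ρ) := by
        gcongr
        exact integral_abs_sub_shift_le hρ.measurable hρ.boundedVariation h
    _ = r / 2 * |h| * bvNorm ρ := by ring

end Variation

section ProductMeasure

open Measure Function

variable {ι : Type*} [DecidableEq ι]

theorem map_update_infinitePi_prod {X : ι → Type*} [∀ i, MeasurableSpace (X i)]
    (μ : ∀ i, Measure (X i)) [∀ i, IsProbabilityMeasure (μ i)] (k : ι) :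
    ((infinitePi μ).prod (μ k)).map (fun p => update p.1 k p.2) = infinitePi μ := by
  refine eq_infinitePi μ fun s t ht => ?_
  have hpre : (fun p : (∀ i, X i) × X k => update p.1 k p.2) ⁻¹' (s : Set ι).pi t =
      ((s.erase k : Finset ι) : Set ι).pi t ×ˢ {y | k ∈ s → y ∈ t k} := by
    ext p
    simp only [Set.mem_preimage, Set.update_mem_pi_iff, Finset.coe_erase, Finset.mem_coe,
      Set.mem_prod, Set.mem_ofPred_eq]
  rw [map_apply measurable_update' (.pi s.countable_toSet fun i _ => ht i), hpre, prod_prod,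
    infinitePi_pi μ fun i _ => ht i]
  by_cases hk : k ∈ s
  · simp [hk, Finset.prod_erase_mul]
  · simp [hk]

theorem integral_infinitePi_eq_integral_integral_update {X : ι → Type*}
    [∀ i, MeasurableSpace (X i)] {μ : ∀ i, Measure (X i)} [∀ i, IsProbabilityMeasure (μ i)]
    (k : ι) {E : Type*} [NormedAddCommGroup E] [NormedSpace ℝ E] {G : (∀ i, X i) → E}
    (hG : Integrable G (infinitePi μ)) :
    ∫ ω, G ω ∂infinitePi μ = ∫ ω, ∫ s, G (update ω k s) ∂μ k ∂infinitePi μ := by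
  have hmap := map_update_infinitePi_prod μ k
  rw [← hmap] at hG
  conv_lhs => rw [← hmap]
  rw [integral_map measurable_update'.aemeasurable hG.aestronglyMeasurable]
  exact integral_prod _ (hG.comp_measurable measurable_update')

theorem integrable_integral_update {X : ι → Type*}
    [∀ i, MeasurableSpace (X i)] {μ : ∀ i, Measure (X i)} [∀ i, IsProbabilityMeasure (μ i)]
    (k : ι) {E : Type*} [NormedAddCommGroup E] [NormedSpace ℝ E] {G : (∀ i, X i) → E}
    (hG : Integrable G (infinitePi μ)) :
    Integrable (fun ω => ∫ s, G (update ω k s) ∂μ k) (infinitePi μ) := by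
  rw [← map_update_infinitePi_prod μ k] at hG
  exact (hG.comp_measurable measurable_update').integral_prod_left

variable {μ : ι → Measure ℝ} [∀ i, IsProbabilityMeasure (μ i)] {G : (ι → ℝ) → ℝ} {C r : ℝ}

theorem IsBVDensity.integral_sub_shift_single_le (hG : Measurable G) (hC : ∀ ω, ‖G ω‖ ≤ C)
    {k : ι} {ρ : ℝ → ℝ} (hρ : IsBVDensity (μ k) ρ)
    (hr : ∀ ω s t, G (update ω k s) - G (update ω k t) ≤ r) (h : ℝ) :
    ∫ ω, G ω ∂infinitePi μ - ∫ ω, G (ω + Pi.single k h) ∂infinitePi μ ≤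
      r / 2 * |h| * bvNorm ρ := by
  have hint : Integrable G (infinitePi μ) :=
    .of_bound hG.aestronglyMeasurable C (ae_of_all _ hC)
  have hint_shift : Integrable (fun ω => G (ω + Pi.single k h)) (infinitePi μ) :=
    .of_bound (hG.comp (measurable_id.add_const _)).aestronglyMeasurable C
      (ae_of_all _ fun _ => hC _)
  have hupd (ω : ι → ℝ) (s : ℝ) : update ω k s + Pi.single k h = update ω k (s + h) := by
    ext i
    rcases eq_or_ne i k with rfl | hi <;> simp [*]
  rw [integral_infinitePi_eq_integral_integral_update k hint,
    integral_infinitePi_eq_integral_integral_update k hint_shift,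
    ← integral_sub (integrable_integral_update k hint) (integrable_integral_update k hint_shift)]
  calc ∫ ω, (∫ s, G (update ω k s) ∂μ k - ∫ s, G (update ω k s + Pi.single k h) ∂μ k) ∂infinitePi μ
      ≤ ∫ _, r / 2 * |h| * bvNorm ρ ∂infinitePi μ := by
        refine integral_mono ((integrable_integral_update k hint).sub
          (integrable_integral_update k hint_shift)) (integrable_const _) fun ω => ?_
        simp only [hupd]
        exact hρ.integral_sub_shift_le (hG.comp (measurable_update ω)) (hr ω) h
    _ = r / 2 * |h| * bvNorm ρ := by simp

theorem integral_sub_shift_sum_le (hG : Measurable G) (hC : ∀ ω, ‖G ω‖ ≤ C) {ρ : ι → ℝ → ℝ}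
    (S : Finset ι) (hρ : ∀ k ∈ S, IsBVDensity (μ k) (ρ k))
    (hr : ∀ k ∈ S, ∀ ω s t, G (update ω k s) - G (update ω k t) ≤ r) (h : ι → ℝ) :
    ∫ ω, G ω ∂infinitePi μ - ∫ ω, G (ω + ∑ k ∈ S, Pi.single k (h k)) ∂infinitePi μ ≤
      ∑ k ∈ S, r / 2 * |h k| * bvNorm (ρ k) := by
  induction S using Finset.induction_on with
  | empty => simp
  | insert k S hk ih =>
    have hupd (ω : ι → ℝ) (s : ℝ) : update ω k s + ∑ j ∈ S, Pi.single j (h j) =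
        update (ω + ∑ j ∈ S, Pi.single j (h j)) k s := by
      ext i
      rcases eq_or_ne i k with rfl | hi
      · simp [Finset.sum_apply, Pi.single_apply, hk]
      · simp [hi]
    have hstep := (hρ k (S.mem_insert_self k)).integral_sub_shift_single_le
      (G := fun ω => G (ω + ∑ j ∈ S, Pi.single j (h j))) (hG.comp (measurable_id.add_const _))
      (fun _ => hC _) (fun ω s t => by
        simp only [hupd]
        exact hr k (S.mem_insert_self k) _ s t) (h k)
    have hrest := ih (fun j hj => hρ j (Finset.mem_insert_of_mem hj))
      fun j hj => hr j (Finset.mem_insert_of_mem hj)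
    simp only [Finset.sum_insert hk, ← add_assoc]
    linarith

end ProductMeasure

section Wegner

open Matrix Filter Topology Set

variable {u ω : (Fin d → ℤ) → ℝ} {lam : ℝ} {L : ℕ}

theorem measurable_potential (u : (Fin d → ℤ) → ℝ) (x : Fin d → ℤ) :
    Measurable fun ω : (Fin d → ℤ) → ℝ => potential u ω x :=
  Measurable.tsum fun k => (measurable_pi_apply k).mul_const _

theorem potential_update_of_eq_zero {x k : Fin d → ℤ} (h : u (x - k) = 0)
    (ω : (Fin d → ℤ) → ℝ) (s : ℝ) : potential u (Function.update ω k s) x = potential u ω x := by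
  refine tsum_congr fun j => ?_
  rcases eq_or_ne j k with rfl | hj
  · simp [h]
  · rw [Function.update_of_ne hj]

theorem potential_add_sum_single {x : Fin d → ℤ} (hω : Summable fun k => ω k * u (x - k))
    (S : Finset (Fin d → ℤ)) (h : (Fin d → ℤ) → ℝ) :
    potential u (ω + ∑ k ∈ S, Pi.single k (h k)) x =
      potential u ω x + ∑ k ∈ S, h k * u (x - k) := by
  have hsum (j : Fin d → ℤ) :
      (∑ k ∈ S, Pi.single k (h k)) j * u (x - j) = if j ∈ S then h j * u (x - j) else 0 := by
    simp [Finset.sum_apply, Pi.single_apply]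
  have hshift : HasSum (fun j => (∑ k ∈ S, Pi.single k (h k)) j * u (x - j))
      (∑ k ∈ S, h k * u (x - k)) := by
    simp only [hsum]
    rw [← Finset.sum_congr rfl fun j hj => if_pos hj]
    exact hasSum_sum_of_ne_finset_zero fun j hj => if_neg hj
  simpa only [potential, Pi.add_apply, add_mul] using (hω.hasSum.add hshift).tsum_eq

theorem restricted_sub_restricted (u : (Fin d → ℤ) → ℝ) (lam : ℝ) (L : ℕ)
    (ω ω' : (Fin d → ℤ) → ℝ) :
    restricted u lam L ω' - restricted u lam L ω =
      diagonal fun p : cube d L => ((lam * (potential u ω' p - potential u ω p) : ℝ) : ℂ) := by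
  ext x y
  rcases eq_or_ne x y with rfl | hxy
  · simp [restricted, hamiltonian]
    ring
  · simp [restricted, hamiltonian, hxy]

theorem measurable_eigenvalueMeasure_restricted (u : (Fin d → ℤ) → ℝ) (lam : ℝ) (L : ℕ) :
    Measurable fun ω => eigenvalueMeasure (restricted_isHermitian u lam L ω) := by
  refine measurable_eigenvalueMeasure _ fun x y => ?_
  have := measurable_potential u x
  simp only [restricted, hamiltonian, of_apply]
  fun_prop

/-- The eigenvalue counting function of `H_{ω,L}`: the number of eigenvalues `≤ E`, counted with
multiplicity. It is the integrated density of states without the normalization by the volume. -/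
def eigenvalueCount (u : (Fin d → ℤ) → ℝ) (lam : ℝ) (L : ℕ) (E : ℝ)
    (ω : (Fin d → ℤ) → ℝ) : ℝ :=
  (eigenvalueMeasure (restricted_isHermitian u lam L ω)).real (Iic E)

theorem measurable_eigenvalueCount (u : (Fin d → ℤ) → ℝ) (lam : ℝ) (L : ℕ) (E : ℝ) :
    Measurable (eigenvalueCount u lam L E) :=
  ((Measure.measurable_coe measurableSet_Iic).comp
    (measurable_eigenvalueMeasure_restricted u lam L)).ennreal_toReal

theorem norm_eigenvalueCount_le (u : (Fin d → ℤ) → ℝ) (lam : ℝ) (L : ℕ) (E : ℝ)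
    (ω : (Fin d → ℤ) → ℝ) : ‖eigenvalueCount u lam L E ω‖ ≤ Fintype.card (cube d L) := by
  rw [eigenvalueCount, Real.norm_of_nonneg measureReal_nonneg]
  exact eigenvalueMeasure_real_le_card _ _

theorem spectralTrace_eq_eigenvalueMeasure_real {I : Set ℝ} (hI : MeasurableSet I)
    (ω : (Fin d → ℤ) → ℝ) :
    spectralTrace u lam L I ω = (eigenvalueMeasure (restricted_isHermitian u lam L ω)).real I := by
  rw [spectralTrace, trace_cfc_indicator (restricted_isHermitian u lam L ω) hI]
  exact Complex.ofReal_re _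

instance (μ : Measure ℝ) [IsProbabilityMeasure μ] : IsProbabilityMeasure (couplingLaw d μ) :=
  inferInstanceAs (IsProbabilityMeasure (Measure.infinitePi _))

theorem integrable_eigenvalueCount (u : (Fin d → ℤ) → ℝ) (lam : ℝ) (L : ℕ) (E : ℝ)
    (P : Measure ((Fin d → ℤ) → ℝ)) [IsFiniteMeasure P] :
    Integrable (eigenvalueCount u lam L E) P :=
  .of_bound (measurable_eigenvalueCount u lam L E).aestronglyMeasurable _
    (ae_of_all _ (norm_eigenvalueCount_le u lam L E))

theorem integrable_spectralTrace (u : (Fin d → ℤ) → ℝ) (lam : ℝ) (L : ℕ) {I : Set ℝ}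
    (hI : MeasurableSet I) (P : Measure ((Fin d → ℤ) → ℝ)) [IsFiniteMeasure P] :
    Integrable (spectralTrace u lam L I) P := by
  simp only [funext (spectralTrace_eq_eigenvalueMeasure_real (u := u) (lam := lam) (L := L) hI)]
  refine .of_bound ((Measure.measurable_coe hI).comp
    (measurable_eigenvalueMeasure_restricted u lam L)).ennreal_toReal.aestronglyMeasurable
    (Fintype.card (cube d L)) (ae_of_all _ fun ω => ?_)
  exact (Real.norm_of_nonneg measureReal_nonneg).trans_le (eigenvalueMeasure_real_le_card _ _)

theorem spectralTrace_Icc_le {a b c : ℝ} (hab : a < b) (hac : a ≤ c) (ω : (Fin d → ℤ) → ℝ) :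
    spectralTrace u lam L (Icc b c) ω ≤
      eigenvalueCount u lam L c ω - eigenvalueCount u lam L a ω := by
  rw [spectralTrace_eq_eigenvalueMeasure_real measurableSet_Icc, eigenvalueCount, eigenvalueCount,
    ← measureReal_sdiff (Iic_subset_Iic.2 hac) measurableSet_Iic]
  exact measureReal_mono fun x hx => ⟨hx.2, not_le.2 (hab.trans_le hx.1)⟩

theorem eigenvalueCount_update_sub_le {k : Fin d → ℤ} {r : ℕ}
    (hr : ((cube d L).filter fun x => u (x - k) ≠ 0).card ≤ r) (E : ℝ)
    (ω : (Fin d → ℤ) → ℝ) (s t : ℝ) :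
    eigenvalueCount u lam L E (Function.update ω k s) -
      eigenvalueCount u lam L E (Function.update ω k t) ≤ r := by
  have hcard : (Finset.univ.filter fun p : cube d L => u (p - k) ≠ 0).card ≤ r := by
    rw [← Finset.card_map (Function.Embedding.subtype _)]
    convert hr using 2
    ext x
    simp [and_comm]
  have hle := eigenvalueMeasure_real_Iic_le_of_sub_eq_diagonal
    (restricted_isHermitian u lam L (Function.update ω k s))
    (restricted_isHermitian u lam L (Function.update ω k t)) (E := E) (E' := E)
    (w := fun p => lam * (potential u (Function.update ω k t) p -
      potential u (Function.update ω k s) p))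
    (restricted_sub_restricted ..) (Finset.univ.filter fun p => u (p - k) ≠ 0) fun p hp => by
      have hp : u (p - k) = 0 := by simpa using hp
      simp [potential_update_of_eq_zero hp]
  have hcard' : ((Finset.univ.filter fun p : cube d L => u (p - k) ≠ 0).card : ℝ) ≤ r :=
    mod_cast hcard
  rw [eigenvalueCount, eigenvalueCount]
  linarith

theorem eigenvalueCount_add_sum_single_le (hω : ∀ x, Summable fun k => ω k * u (x - k))
    {S : Finset (Fin d → ℤ)} {h : (Fin d → ℤ) → ℝ} {E E' : ℝ}
    (hh : ∀ x ∈ cube d L, E' - E ≤ lam * ∑ k ∈ S, h k * u (x - k)) :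
    eigenvalueCount u lam L E' (ω + ∑ k ∈ S, Pi.single k (h k)) ≤ eigenvalueCount u lam L E ω := by
  set ω' := ω + ∑ k ∈ S, Pi.single k (h k)
  have hle := eigenvalueMeasure_real_Iic_le_of_sub_eq_diagonal
    (restricted_isHermitian u lam L ω') (restricted_isHermitian u lam L ω) (E := E') (E' := E)
    (w := fun p => lam * (potential u ω p - potential u ω' p))
    (restricted_sub_restricted ..) ∅ fun p _ => by
      have hpot : potential u ω' p = _ := potential_add_sum_single (hω p) S h
      linear_combination hh p p.2 - lam * hpot
  simpa only [eigenvalueCount, Finset.card_empty, Nat.cast_zero, add_zero] using hle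

/-- The series defining the potential `V_ω` converges at every site for almost every `ω`; where it
does not, `potential` has the default value `0`. -/
def PotentialConverges (u : (Fin d → ℤ) → ℝ) (μ : Measure ℝ) [IsProbabilityMeasure μ] : Prop :=
  ∀ᵐ ω ∂couplingLaw d μ, ∀ x, Summable fun k => ω k * u (x - k)

variable {μ : Measure ℝ} [IsProbabilityMeasure μ] {ρ : ℝ → ℝ} {r : ℕ} {S : Finset (Fin d → ℤ)}
  {a : (Fin d → ℤ) → ℝ} {c δ : ℝ}

theorem WegnerBound.mono {E ε K K' : ℝ} (h : WegnerBound u lam μ L E ε K) (hK : K ≤ K') :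
    WegnerBound u lam μ L E ε K' :=
  ⟨h.1, h.2.trans hK⟩

-- The shift `ω ↦ ω + t a` with `λ t δ = E' - E` raises the spectrum by at least `E' - E`, so the
-- left-hand side is the change of `∫ N(E')` under this shift of the coupling constants.
theorem integral_eigenvalueCount_sub_le (hρ : IsBVDensity μ ρ) (hconv : PotentialConverges u μ)
    (hlam : 0 < lam) (hδ : 0 < δ) (hcov : ∀ x ∈ cube d L, δ ≤ ∑ k ∈ S, a k * u (x - k))
    (hr : ∀ k ∈ S, ((cube d L).filter fun x => u (x - k) ≠ 0).card ≤ r)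
    {E E' : ℝ} (hE : E ≤ E') :
    ∫ ω, eigenvalueCount u lam L E' ω ∂couplingLaw d μ -
        ∫ ω, eigenvalueCount u lam L E ω ∂couplingLaw d μ ≤
      (E' - E) / (2 * (lam * δ)) * (∑ k ∈ S, |a k|) * r * bvNorm ρ := by
  set t := (E' - E) / (lam * δ) with ht
  have ht0 : 0 ≤ t := div_nonneg (sub_nonneg.2 hE) (by positivity)
  have hmeas := measurable_eigenvalueCount u lam L E'
  have hbound := norm_eigenvalueCount_le u lam L E'
  have hlift (x) (hx : x ∈ cube d L) : E' - E ≤ lam * ∑ k ∈ S, t * a k * u (x - k) := by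
    simp only [mul_assoc, ← Finset.mul_sum]
    calc E' - E = lam * (t * δ) := by rw [ht]; field_simp
      _ ≤ lam * (t * ∑ k ∈ S, a k * u (x - k)) := by gcongr; exact hcov x hx
  have hmono : ∫ ω, eigenvalueCount u lam L E' (ω + ∑ k ∈ S, Pi.single k (t * a k))
        ∂couplingLaw d μ ≤ ∫ ω, eigenvalueCount u lam L E ω ∂couplingLaw d μ := by
    refine integral_mono_ae ?_ (integrable_eigenvalueCount ..) ?_
    · exact .of_bound (hmeas.comp (measurable_id.add_const _)).aestronglyMeasurable _
        (ae_of_all _ fun _ => hbound _)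
    · filter_upwards [hconv] with ω hω
      exact eigenvalueCount_add_sum_single_le hω hlift
  have hshift := integral_sub_shift_sum_le hmeas hbound S (fun _ _ => hρ)
    (fun k hk => eigenvalueCount_update_sub_le (hr k hk) E') fun k => t * a k
  calc _ ≤ _ := sub_le_sub_left hmono _
    _ ≤ ∑ k ∈ S, r / 2 * |t * a k| * bvNorm ρ := hshift
    _ = t / 2 * (∑ k ∈ S, |a k|) * r * bvNorm ρ := by
      simp only [abs_mul, abs_of_nonneg ht0, Finset.mul_sum, Finset.sum_mul]
      exact Finset.sum_congr rfl fun k _ => by ring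
    _ = _ := by rw [ht]; field_simp

theorem wegnerBound_of_le_sum (hρ : IsBVDensity μ ρ) (hconv : PotentialConverges u μ)
    (hlam : 0 < lam) (hδ : 0 < δ) (hcov : ∀ x ∈ cube d L, δ ≤ ∑ k ∈ S, a k * u (x - k))
    (hr : ∀ k ∈ S, ((cube d L).filter fun x => u (x - k) ≠ 0).card ≤ r)
    (E : ℝ) {ε : ℝ} (hε : 0 < ε) :
    WegnerBound u lam μ L E ε (ε / (lam * δ) * (∑ k ∈ S, |a k|) * r * bvNorm ρ) := by
  refine ⟨integrable_spectralTrace u lam L measurableSet_Icc _, ?_⟩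
  have hwider : ∀ η > 0, ∫ ω, spectralTrace u lam L (Icc (E - ε) (E + ε)) ω ∂couplingLaw d μ ≤
      (E + ε - (E - ε - η)) / (2 * (lam * δ)) * (∑ k ∈ S, |a k|) * r * bvNorm ρ := by
    intro η hη
    refine le_trans ?_ (integral_eigenvalueCount_sub_le hρ hconv hlam hδ hcov hr (by linarith))
    rw [← integral_sub (integrable_eigenvalueCount ..) (integrable_eigenvalueCount ..)]
    exact integral_mono (integrable_spectralTrace u lam L measurableSet_Icc _)
      ((integrable_eigenvalueCount ..).sub (integrable_eigenvalueCount ..))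
      (spectralTrace_Icc_le (by linarith) (by linarith))
  have hlim : Tendsto (fun η => (E + ε - (E - ε - η)) / (2 * (lam * δ)) * (∑ k ∈ S, |a k|) * r *
      bvNorm ρ) (𝓝[>] 0) (𝓝 (ε / (lam * δ) * (∑ k ∈ S, |a k|) * r * bvNorm ρ)) := by
    refine (Continuous.tendsto' (by fun_prop) 0 _ ?_).mono_left nhdsWithin_le_nhds
    field_simp
    ring
  exact ge_of_tendsto hlim (eventually_mem_nhdsWithin.mono hwider)

theorem wegnerBound_of_abs_sum_sub_le (hρ : IsBVDensity μ ρ) (hconv : PotentialConverges u μ)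
    (hlam : 0 < lam) (hc : c ≠ 0)
    (hcov : ∀ x ∈ cube d L, |∑ k ∈ S, a k * u (x - k) - c| ≤ |c| / 2)
    (hr : ∀ k ∈ S, ((cube d L).filter fun x => u (x - k) ≠ 0).card ≤ r)
    (E : ℝ) {ε : ℝ} (hε : 0 < ε) :
    WegnerBound u lam μ L E ε (2 * ε / (lam * |c|) * (∑ k ∈ S, |a k|) * r * bvNorm ρ) := by
  obtain ⟨σ, hσ, hσc⟩ : ∃ σ : ℝ, |σ| = 1 ∧ σ * c = |c| :=
    ⟨c / |c|, by rw [abs_div, abs_abs, div_self (abs_ne_zero.2 hc)],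
      by rw [div_mul_eq_mul_div, ← abs_mul_abs_self, mul_self_div_self]⟩
  have hcov' (x) (hx : x ∈ cube d L) : |c| / 2 ≤ ∑ k ∈ S, σ * a k * u (x - k) := by
    simp only [mul_assoc, ← Finset.mul_sum]
    have hle : |σ * (∑ k ∈ S, a k * u (x - k) - c)| ≤ |c| / 2 := by
      rw [abs_mul, hσ, one_mul]
      exact hcov x hx
    linarith [neg_le_of_abs_le hle]
  refine (wegnerBound_of_le_sum hρ hconv hlam (half_pos (abs_pos.2 hc)) hcov' hr E hε).mono
    (le_of_eq ?_)
  simp only [abs_mul, hσ, one_mul]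
  field_simp

theorem PotentialConverges.of_finite_support (hu : (Function.support u).Finite) :
    PotentialConverges u μ := by
  refine ae_of_all _ fun ω x => summable_of_hasFiniteSupport ?_
  exact (hu.preimage (f := fun k => x - k) sub_right_injective.injOn).subset
    fun k hk => right_ne_zero_of_mul hk

theorem PotentialConverges.of_isBounded_support (hu : Summable u) (hρ : IsBVDensity μ ρ)
    (hb : Bornology.IsBounded (Function.support ρ)) : PotentialConverges u μ := by
  obtain ⟨R, hR⟩ := hb.exists_norm_le
  have hbound : ∀ᵐ ω ∂couplingLaw d μ, ∀ k, |ω k| ≤ R :=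
    ae_all_iff.2 fun k => (measurePreserving_eval_infinitePi
      (fun _ : Fin d → ℤ => μ) k).quasiMeasurePreserving.ae (hρ.ae_mem_support.mono hR)
  filter_upwards [hbound] with ω hω x
  have htrans : Summable fun k => u (x - k) := (Equiv.subLeft x).summable_iff.2 hu
  refine .of_norm_bounded (htrans.abs.mul_left R) fun k => ?_
  rw [Real.norm_eq_abs, abs_mul]
  exact mul_le_mul_of_nonneg_right (hω k) (abs_nonneg _)

end Wegner

section LatticeCounting

theorem mem_cube {L : ℕ} {k : Fin d → ℤ} : k ∈ cube d L ↔ ∀ i, (k i).natAbs ≤ L := by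
  simp only [cube, Finset.mem_Icc, Pi.le_def, ← forall_and]
  exact forall_congr' fun i => by omega

theorem card_cube (d L : ℕ) : (cube d L).card = (2 * L + 1) ^ d := by
  rw [cube, Pi.card_Icc]
  simp only [Int.card_Icc, Finset.prod_const, Finset.card_univ, Fintype.card_fin]
  congr 1
  omega

/-- The lattice points at `ℓ¹` distance less than `m` from the cube `Λ_L`. The distance is the sum
of the truncated differences `|k i| - L`. -/
def cubeNhd (d L m : ℕ) : Finset (Fin d → ℤ) :=
  (cube d (L + m)).filter fun k => ∑ i, ((k i).natAbs - L) < m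

theorem mem_cubeNhd {L m : ℕ} {k : Fin d → ℤ} :
    k ∈ cubeNhd d L m ↔ ∑ i, ((k i).natAbs - L) < m := by
  rw [cubeNhd, Finset.mem_filter, and_iff_right_iff_imp, mem_cube]
  intro h i
  have := Finset.single_le_sum (f := fun i => (k i).natAbs - L) (fun _ _ => Nat.zero_le _)
    (Finset.mem_univ i)
  omega

theorem cubeNhd_zero (d L : ℕ) : cubeNhd d L 0 = ∅ :=
  Finset.filter_false_of_mem fun _ _ => Nat.not_lt_zero _

theorem le_l1norm_sub_of_notMem_cubeNhd {L m : ℕ} {x k : Fin d → ℤ} (hx : x ∈ cube d L)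
    (hk : k ∉ cubeNhd d L m) : (m : ℤ) ≤ l1norm (x - k) := by
  rw [mem_cubeNhd, not_lt] at hk
  have hle : ∑ i, ((k i).natAbs - L) ≤ ∑ i, (x i - k i).natAbs :=
    Finset.sum_le_sum fun i _ => by have := mem_cube.1 hx i; omega
  calc (m : ℤ) ≤ ((∑ i, (x i - k i).natAbs : ℕ) : ℤ) := mod_cast hk.trans hle
    _ = l1norm (x - k) := by simp [l1norm]

theorem sum_Icc_natAbs_sub {M : Type*} [CommSemiring M] (L m : ℕ) (f : ℕ → M) :
    ∑ j ∈ Finset.Icc (-(L + m : ℤ)) (L + m), f (j.natAbs - L) =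
      (2 * L + 1) * f 0 + 2 * ∑ i ∈ Finset.range m, f (i + 1) := by
  induction m with
  | zero =>
    have hcard : (Finset.Icc (-(L : ℤ)) L).card = 2 * L + 1 := by
      rw [Int.card_Icc]
      omega
    have hconst : ∀ j ∈ Finset.Icc (-(L : ℤ)) L, f (j.natAbs - L) = f 0 := fun j hj => by
      rw [Finset.mem_Icc] at hj
      congr 1
      omega
    simpa [hcard] using Finset.sum_congr rfl hconst
  | succ m ih =>
    have hsplit : Finset.Icc (-(L + (m + 1 : ℕ) : ℤ)) (L + (m + 1 : ℕ)) =
        insert (-(L + (m + 1 : ℕ) : ℤ)) (insert (L + (m + 1 : ℕ) : ℤ)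
          (Finset.Icc (-(L + m : ℤ)) (L + m))) := by
      ext j
      simp only [Finset.mem_Icc, Finset.mem_insert]
      omega
    have hneg : (-(L + (m + 1 : ℕ) : ℤ)).natAbs - L = m + 1 := by omega
    have hpos : (L + (m + 1 : ℕ) : ℤ).natAbs - L = m + 1 := by omega
    rw [hsplit, Finset.sum_insert, Finset.sum_insert, ih, Finset.sum_range_succ, hneg, hpos]
    · ring
    all_goals
      simp only [Finset.mem_Icc, Finset.mem_insert]
      omega

theorem card_cubeNhd_succ_le (d L m : ℕ) :
    (cubeNhd (d + 1) L m).card ≤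
      (2 * L + 1) * (cubeNhd d L m).card + 2 * ∑ i ∈ Finset.range m, (cubeNhd d L i).card := by
  rw [← Finset.sum_range_reflect]
  calc (cubeNhd (d + 1) L m).card
      = ∑ j ∈ Finset.Icc (-(L + m : ℤ)) (L + m),
          ((cubeNhd (d + 1) L m).filter fun k => k 0 = j).card := by
        refine Finset.card_eq_sum_card_fiberwise fun k hk => ?_
        have := mem_cube.1 (Finset.mem_filter.1 hk).1 0
        rw [Finset.mem_coe, Finset.mem_Icc]
        omega
    _ ≤ ∑ j ∈ Finset.Icc (-(L + m : ℤ)) (L + m), (cubeNhd d L (m - (j.natAbs - L))).card := by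
        refine Finset.sum_le_sum fun j _ =>
          Finset.card_le_card_of_injOn Fin.tail (fun k hk => ?_) fun k hk k' hk' h => ?_
        · rw [Finset.mem_coe, Finset.mem_filter, mem_cubeNhd, Fin.sum_univ_succ] at hk
          rw [Finset.mem_coe, mem_cubeNhd]
          obtain ⟨hk, rfl⟩ := hk
          exact lt_tsub_iff_left.2 hk
        · rw [Finset.mem_coe, Finset.mem_filter] at hk hk'
          rw [← Fin.cons_self_tail k, ← Fin.cons_self_tail k', h, hk.2, hk'.2]
    _ = _ := by
        rw [sum_Icc_natAbs_sub L m fun i => (cubeNhd d L (m - i)).card]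
        simp [Nat.sub_sub, add_comm]

theorem add_pow_add_add_pow_le (M i j d : ℕ) :
    (M + i) ^ d + (M + j) ^ d ≤ M ^ d + (M + i + j) ^ d := by
  induction d with
  | zero => simp
  | succ d ih =>
    have hi : (M + i) ^ d ≤ (M + i + j) ^ d := Nat.pow_le_pow_left (by omega) _
    have hj : (M + j) ^ d ≤ (M + i + j) ^ d := Nat.pow_le_pow_left (by omega) _
    simp only [pow_succ]
    linear_combination M * ih + i * hi + j * hj

theorem two_mul_sum_range_add_pow_le (M r d : ℕ) :
    2 * ∑ j ∈ Finset.range r, (M + j) ^ d ≤ r * (M ^ d + (M + r) ^ d) := by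
  calc 2 * ∑ j ∈ Finset.range r, (M + j) ^ d
      = ∑ j ∈ Finset.range r, ((M + (r - 1 - j)) ^ d + (M + j) ^ d) := by
        rw [Finset.sum_add_distrib, Finset.sum_range_reflect (fun j => (M + j) ^ d), two_mul]
    _ ≤ ∑ _ ∈ Finset.range r, (M ^ d + (M + r) ^ d) := by
        refine Finset.sum_le_sum fun j hj => (add_pow_add_add_pow_le _ _ _ _).trans ?_
        have := Finset.mem_range.1 hj
        exact Nat.add_le_add_left (Nat.pow_le_pow_left (by omega) d) _
    _ = r * (M ^ d + (M + r) ^ d) := by simp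

theorem card_cubeNhd_succ_add_le (d L r : ℕ) :
    (cubeNhd d L (r + 1)).card + (2 * L + 1) ^ d ≤ 2 * (2 * L + 1 + r) ^ d := by
  induction d generalizing r with
  | zero =>
    have : (cubeNhd 0 L (r + 1)).card ≤ 1 := Finset.card_le_one_of_subsingleton _
    simpa using this
  | succ d ih =>
    have hrec := card_cubeNhd_succ_le d L (r + 1)
    rw [Finset.sum_range_succ', cubeNhd_zero, Finset.card_empty, add_zero] at hrec
    have htrapezoid := two_mul_sum_range_add_pow_le (2 * L + 1) r d
    have hsum : ∑ i ∈ Finset.range r, (cubeNhd d L (i + 1)).card + r * (2 * L + 1) ^ d ≤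
        2 * ∑ i ∈ Finset.range r, (2 * L + 1 + i) ^ d := by
      have hconst : r * (2 * L + 1) ^ d = ∑ i ∈ Finset.range r, (2 * L + 1) ^ d := by simp
      rw [hconst, ← Finset.sum_add_distrib, Finset.mul_sum]
      exact Finset.sum_le_sum fun i _ => ih i
    simp only [pow_succ]
    linear_combination hrec + 2 * hsum + 2 * htrapezoid + (2 * L + 1) * ih r

theorem card_cubeNhd_le (d L m : ℕ) : (cubeNhd d L m).card ≤ 2 * (2 * L + m) ^ d := by
  cases m with
  | zero => simp [cubeNhd_zero]
  | succ r =>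
    exact (Nat.le_add_right _ _).trans ((card_cubeNhd_succ_add_le d L r).trans_eq (by ring))

theorem add_one_pow_le_two_mul_pow {M d : ℕ} (h : 2 * d ≤ M) : (M + 1) ^ d ≤ 2 * M ^ d := by
  have hd : 2 * (d : ℝ) ≤ M := mod_cast h
  have hM : (0 : ℝ) < M + 1 := by positivity
  have hbernoulli : (1 / 2 : ℝ) ≤ (M / (M + 1)) ^ d :=
    calc (1 / 2 : ℝ) ≤ 1 + d * -(1 / (M + 1)) := by
          field_simp
          linarith
      _ ≤ (1 + -(1 / (M + 1))) ^ d := by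
          refine one_add_mul_le_pow (neg_le_neg ?_) d
          rw [div_le_iff₀ hM]
          linarith [M.cast_nonneg (α := ℝ)]
      _ = (M / (M + 1)) ^ d := by
          congr 1
          field_simp
          ring
  rw [div_pow, div_le_div_iff₀ two_pos (by positivity), one_mul] at hbernoulli
  exact_mod_cast hbernoulli.trans_eq (mul_comm _ _)

theorem coe_minSupp (u : (Fin d → ℤ) → ℝ) (M : ℕ) :
    (minSupp u M : ℕ∞) = min (M : ℕ∞) (Function.support u).encard :=
  ENat.natCast_toNat (ne_top_of_le_ne_top (ENat.natCast_ne_top M) (min_le_left _ _))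

theorem minSupp_le_two_mul (u : (Fin d → ℤ) → ℝ) {M N : ℕ} (h : M ≤ 2 * N) :
    minSupp u M ≤ 2 * minSupp u N := by
  rw [← Nat.cast_le (α := ℕ∞), Nat.cast_mul, coe_minSupp, coe_minSupp]
  rcases le_total (N : ℕ∞) (Function.support u).encard with hN | hN
  · rw [min_eq_left hN]
    exact (min_le_left _ _).trans (mod_cast h)
  · rw [min_eq_right hN]
    exact (min_le_right _ _).trans (le_mul_of_one_le_left' one_le_two)

theorem card_filter_apply_sub_le_encard (u : (Fin d → ℤ) → ℝ) (s : Finset (Fin d → ℤ))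
    (k : Fin d → ℤ) :
    ((s.filter fun x => u (x - k) ≠ 0).card : ℕ∞) ≤ (Function.support u).encard := by
  rw [← Set.encard_coe_eq_coe_finsetCard]
  exact Set.encard_le_encard_of_injOn (f := fun x => x - k)
    (fun x hx => (Finset.mem_filter.1 hx).2) sub_left_injective.injOn

theorem card_filter_cube_le_minSupp (u : (Fin d → ℤ) → ℝ) (L : ℕ) (k : Fin d → ℤ) :
    ((cube d L).filter fun x => u (x - k) ≠ 0).card ≤ minSupp u ((2 * L + 1) ^ d) := by
  rw [← Nat.cast_le (α := ℕ∞), coe_minSupp, le_min_iff]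
  exact ⟨mod_cast card_cube d L ▸ Finset.card_filter_le _ _,
    card_filter_apply_sub_le_encard u _ k⟩

end LatticeCounting

section NonzeroMean

theorem norm_sum_sub_le_of_hasSum {β E : Type*} [SeminormedAddCommGroup E] {f : β → E} {g : β → ℝ}
    {a : E} {b : ℝ} (hf : HasSum f a) (hg : HasSum g b) (S : Finset β) (hg0 : ∀ k ∈ S, 0 ≤ g k)
    (hfg : ∀ k ∉ S, ‖f k‖ ≤ g k) : ‖∑ k ∈ S, f k - a‖ ≤ b := by
  classical
  have hS : HasSum (fun k => if k ∈ S then f k else 0) (∑ k ∈ S, f k) := by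
    rw [← Finset.sum_congr rfl fun k hk => if_pos hk]
    exact hasSum_sum_of_ne_finset_zero fun k hk => if_neg hk
  refine (hS.sub hf).norm_le_of_bounded hg fun k => ?_
  by_cases hk : k ∈ S
  · simpa [hk] using hg0 k hk
  · simpa [hk] using hfg k hk

theorem bvNorm_nonneg (ρ : ℝ → ℝ) : 0 ≤ bvNorm ρ :=
  ENNReal.toReal_nonneg

variable {u : (Fin d → ℤ) → ℝ} {m : ℕ}

theorem abs_sum_cubeNhd_sub_tsum_le (hu : Summable u) {L : ℕ} {x : Fin d → ℤ}
    (hx : x ∈ cube d L) :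
    |∑ k ∈ cubeNhd d L m, u (x - k) - ∑' k, u k| ≤
      ∑' k : {k : Fin d → ℤ | (m : ℤ) ≤ l1norm k}, |u k| := by
  set far := {k : Fin d → ℤ | (m : ℤ) ≤ l1norm k}
  rw [tsum_subtype far fun k => |u k|]
  refine norm_sum_sub_le_of_hasSum ((Equiv.subLeft x).hasSum_iff.2 hu.hasSum)
    ((Equiv.subLeft x).hasSum_iff.2 (hu.abs.indicator far).hasSum) _
    (fun k _ => Set.indicator_nonneg (fun j _ => abs_nonneg (u j)) _) fun k hk => ?_
  have hfar : x - k ∈ far := le_l1norm_sub_of_notMem_cubeNhd hx hk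
  simp [hfar]

variable {μ : Measure ℝ} [IsProbabilityMeasure μ] {ρ : ℝ → ℝ} {lam ε : ℝ}

theorem wegnerBound_of_tsum_ne_zero (hu0 : ∑' k, u k ≠ 0) (hρ : IsBVDensity μ ρ)
    (hconv : PotentialConverges u μ)
    (hm : (∑' k : {k : Fin d → ℤ | (m : ℤ) ≤ l1norm k}, |u k|) ≤ |(∑' k, u k) / 2|)
    (hlam : 0 < lam) (L : ℕ) (E : ℝ) (hε : 0 < ε) :
    WegnerBound u lam μ L E ε (4 / (lam * |∑' k, u k|) * (minSupp u ((2 * L + 1) ^ d) : ℝ) *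
      bvNorm ρ * ε * (2 * (L : ℝ) + m) ^ d) := by
  have hu : Summable u := not_imp_comm.1 tsum_eq_zero_of_not_summable hu0
  have hcov (x) (hx : x ∈ cube d L) :
      |∑ k ∈ cubeNhd d L m, 1 * u (x - k) - ∑' k, u k| ≤ |∑' k, u k| / 2 := by
    simpa only [one_mul, abs_div, abs_two] using (abs_sum_cubeNhd_sub_tsum_le hu hx).trans hm
  have hcard : ((cubeNhd d L m).card : ℝ) ≤ 2 * (2 * (L : ℝ) + m) ^ d :=
    mod_cast card_cubeNhd_le d L m
  refine (wegnerBound_of_abs_sum_sub_le hρ hconv hlam hu0 hcov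
    (fun k _ => card_filter_cube_le_minSupp u L k) E hε).mono ?_
  calc 2 * ε / (lam * |∑' k, u k|) * (∑ k ∈ cubeNhd d L m, |1|) *
        (minSupp u ((2 * L + 1) ^ d) : ℝ) * bvNorm ρ
      ≤ 2 * ε / (lam * |∑' k, u k|) * (2 * (2 * (L : ℝ) + m) ^ d) *
        (minSupp u ((2 * L + 1) ^ d) : ℝ) * bvNorm ρ := by
        have := bvNorm_nonneg ρ
        gcongr
        simpa using hcard
    _ = _ := by ring

theorem wegnerBound_of_tsum_ne_zero_of_le (hu0 : ∑' k, u k ≠ 0) (hρ : IsBVDensity μ ρ)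
    (hconv : PotentialConverges u μ)
    (hm : (∑' k : {k : Fin d → ℤ | (m : ℤ) ≤ l1norm k}, |u k|) ≤ |(∑' k, u k) / 2|)
    (hlam : 0 < lam) {L : ℕ} (hL : d ≤ L) (E : ℝ) (hε : 0 < ε) :
    WegnerBound u lam μ L E ε (8 / (lam * |∑' k, u k|) * (minSupp u ((2 * L) ^ d) : ℝ) *
      bvNorm ρ * ε * (2 * (L : ℝ) + m) ^ d) := by
  have hmin : (minSupp u ((2 * L + 1) ^ d) : ℝ) ≤ 2 * minSupp u ((2 * L) ^ d) :=
    mod_cast minSupp_le_two_mul u (add_one_pow_le_two_mul_pow (by omega))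
  refine (wegnerBound_of_tsum_ne_zero hu0 hρ hconv hm hlam L E hε).mono ?_
  calc 4 / (lam * |∑' k, u k|) * (minSupp u ((2 * L + 1) ^ d) : ℝ) * bvNorm ρ * ε *
        (2 * (L : ℝ) + m) ^ d
      ≤ 4 / (lam * |∑' k, u k|) * (2 * minSupp u ((2 * L) ^ d)) * bvNorm ρ * ε *
        (2 * (L : ℝ) + m) ^ d := by
        have := bvNorm_nonneg ρ
        gcongr
    _ = _ := by ring

end NonzeroMean

section Moments

open Polynomial

/-- The monomial `k ↦ k^I` on the lattice. -/
def latticeMonomial (I : Fin d → ℕ) (k : Fin d → ℤ) : ℝ := ∏ i, (k i : ℝ) ^ I i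

/-- The moment `∑_k k^I u(k)` of order `I`, with the default value `0` if the series diverges. -/
def moment (u : (Fin d → ℤ) → ℝ) (I : Fin d → ℕ) : ℝ := ∑' k, latticeMonomial I k * u k

theorem abs_latticeMonomial_le {I : Fin d → ℕ} {k : Fin d → ℤ} {R : ℝ}
    (h : ∀ i, |(k i : ℝ)| ≤ R) : |latticeMonomial I k| ≤ R ^ ∑ i, I i := by
  rw [latticeMonomial, Finset.abs_prod, ← Finset.prod_pow_eq_pow_sum]
  refine Finset.prod_le_prod (fun i _ => abs_nonneg _) fun i _ => ?_
  rw [abs_pow]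
  exact pow_le_pow_left₀ (abs_nonneg _) (h i) _

theorem sum_abs_latticeMonomial_le {I : Fin d → ℕ} {S : Finset (Fin d → ℤ)} {R : ℝ}
    (h : ∀ k ∈ S, ∀ i, |(k i : ℝ)| ≤ R) :
    ∑ k ∈ S, |latticeMonomial I k| ≤ S.card * R ^ ∑ i, I i := by
  rw [← nsmul_eq_mul]
  exact Finset.sum_le_card_nsmul _ _ _ fun k hk => abs_latticeMonomial_le (h k hk)

variable {u : (Fin d → ℤ) → ℝ} {I : Fin d → ℕ}

theorem hasSum_prod_eval_mul {p : Fin d → ℝ[X]} {N : Fin d → ℕ} (hN : ∀ i, (p i).natDegree ≤ N i)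
    (hs : ∀ J ≤ N, Summable fun k => latticeMonomial J k * u k) :
    HasSum (fun k : Fin d → ℤ => (∏ i, (p i).eval (k i : ℝ)) * u k)
      (∑ J ∈ Finset.Iic N, (∏ i, (p i).coeff (J i)) * moment u J) := by
  have hexpand (k : Fin d → ℤ) : (∏ i, (p i).eval (k i : ℝ)) * u k =
      ∑ J ∈ Finset.Iic N, (∏ i, (p i).coeff (J i)) * (latticeMonomial J k * u k) := by
    have heval (i) : (p i).eval (k i : ℝ) =
        ∑ j ∈ Finset.Iic (N i), (p i).coeff j * (k i : ℝ) ^ j := by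
      rw [eval_eq_sum_range' (Nat.lt_succ_of_le (hN i))]
      exact Finset.sum_congr (by ext; simp) fun _ _ => rfl
    have hpi : Finset.Iic N = Fintype.piFinset fun i => Finset.Iic (N i) := by
      ext J
      simp [Pi.le_def]
    simp only [heval, Finset.prod_univ_sum, Finset.sum_mul, Finset.prod_mul_distrib, ← hpi,
      latticeMonomial, mul_assoc]
  simp only [hexpand]
  exact hasSum_sum fun J hJ => (hs J (Finset.mem_Iic.1 hJ)).hasSum.mul_left _

theorem natDegree_C_sub_X_pow_le {R : Type*} [Ring R] (a : R) (n : ℕ) :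
    ((C a - X) ^ n).natDegree ≤ n := by
  compute_degree

theorem coeff_C_sub_X_pow_self {R : Type*} [Ring R] (a : R) (n : ℕ) :
    ((C a - X) ^ n).coeff n = (-1) ^ n := by
  compute_degree!

theorem hasSum_latticeMonomial_mul_apply_sub
    (hs : ∀ J ≤ I, Summable fun k => latticeMonomial J k * u k)
    (hlow : ∀ J < I, moment u J = 0) (x : Fin d → ℤ) :
    HasSum (fun k => latticeMonomial I k * u (x - k)) ((-1) ^ (∑ i, I i) * moment u I) := by
  rw [← (Equiv.subLeft x).hasSum_iff]
  have h := hasSum_prod_eval_mul (p := fun i => (C (x i : ℝ) - X) ^ I i)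
    (fun i => natDegree_C_sub_X_pow_le _ _) hs
  rw [Finset.sum_eq_single_of_mem I (Finset.mem_Iic.2 le_rfl) fun J hJ hne => by
    rw [hlow J ((Finset.mem_Iic.1 hJ).lt_of_ne hne), mul_zero]] at h
  simp only [coeff_C_sub_X_pow_self, Finset.prod_pow_eq_pow_sum] at h
  simpa [Function.comp_def, latticeMonomial] using h

theorem exists_minimal_moment_ne_zero (hI : moment u I ≠ 0) :
    ∃ J ≤ I, moment u J ≠ 0 ∧ ∀ K < J, moment u K = 0 := by
  obtain ⟨J, hJI, hJ⟩ := exists_minimal_le_of_wellFoundedLT (fun J => moment u J ≠ 0) I hI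
  exact ⟨J, hJI, hJ.prop, fun K hK => not_not.1 (hJ.not_prop_of_lt hK)⟩

end Moments

section FiniteSupport

variable {u : (Fin d → ℤ) → ℝ} {I : Fin d → ℕ} {n : ℕ}

theorem finite_support_of_forall_mem_box (hn : ∀ k, u k ≠ 0 → ∀ i, 0 ≤ k i ∧ k i ≤ (n : ℤ)) :
    (Function.support u).Finite :=
  (Set.finite_Icc 0 fun _ => (n : ℤ)).subset fun k hk =>
    ⟨fun i => (hn k hk i).1, fun i => (hn k hk i).2⟩

theorem summable_latticeMonomial_mul_of_finite_support (hu : (Function.support u).Finite)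
    (J : Fin d → ℕ) : Summable fun k => latticeMonomial J k * u k :=
  summable_of_hasFiniteSupport (hu.subset fun _ hk => right_ne_zero_of_mul hk)

theorem exists_moment_ne_zero_of_forall_mem_box (hu : u ≠ 0)
    (hn : ∀ k, u k ≠ 0 → ∀ i, 0 ≤ k i ∧ k i ≤ (n : ℤ)) :
    ∃ I : Fin d → ℕ, (∀ i, I i ≤ n) ∧ moment u I ≠ 0 := by
  by_contra! hzero
  obtain ⟨k₀, hk₀⟩ := Function.ne_iff.1 hu
  have hinj : Set.InjOn (Int.cast : ℤ → ℝ) (Finset.Icc 0 (n : ℤ)) := Int.cast_injective.injOn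
  have hmem (k) (hk : u k ≠ 0) (i) : k i ∈ Finset.Icc 0 (n : ℤ) := Finset.mem_Icc.2 (hn k hk i)
  let δ (i : Fin d) : Polynomial ℝ := Lagrange.basis (Finset.Icc 0 (n : ℤ)) Int.cast (k₀ i)
  have hdeg (i) : (δ i).natDegree ≤ n := by
    rw [Polynomial.natDegree_le_iff_degree_le, Lagrange.degree_basis hinj (hmem k₀ hk₀ i)]
    simp
  have hsum : HasSum (fun k : Fin d → ℤ => (∏ i, (δ i).eval (k i : ℝ)) * u k) 0 := by
    convert hasSum_prod_eval_mul hdeg fun J _ =>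
      summable_latticeMonomial_mul_of_finite_support (finite_support_of_forall_mem_box hn) J
    refine (Finset.sum_eq_zero fun J hJ => ?_).symm
    rw [hzero J (Finset.mem_Iic.1 hJ), mul_zero]
  have hself : ∏ i, (δ i).eval (k₀ i : ℝ) = 1 :=
    Finset.prod_eq_one fun i _ => Lagrange.eval_basis_self hinj (hmem k₀ hk₀ i)
  have hother (k) (hne : k ≠ k₀) : (∏ i, (δ i).eval (k i : ℝ)) * u k = 0 := by
    by_contra hk
    obtain ⟨i, hi⟩ := Function.ne_iff.1 hne
    exact left_ne_zero_of_mul hk (Finset.prod_eq_zero (Finset.mem_univ i)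
      (Lagrange.eval_basis_of_ne hi.symm (hmem k (right_ne_zero_of_mul hk) i)))
  have := (hasSum_single k₀ hother).unique hsum
  rw [hself, one_mul] at this
  exact hk₀ this

theorem sum_Icc_latticeMonomial_mul_apply_sub (hlow : ∀ J < I, moment u J = 0)
    (hn : ∀ k, u k ≠ 0 → ∀ i, 0 ≤ k i ∧ k i ≤ (n : ℤ)) {L : ℕ} {x : Fin d → ℤ}
    (hx : x ∈ cube d L) :
    ∑ k ∈ Finset.Icc (fun _ => -(L : ℤ) - n) (fun _ => (L : ℤ)), latticeMonomial I k * u (x - k) =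
      (-1) ^ (∑ i, I i) * moment u I := by
  refine (hasSum_sum_of_ne_finset_zero fun k hk => ?_).unique
    (hasSum_latticeMonomial_mul_apply_sub (fun J _ =>
      summable_latticeMonomial_mul_of_finite_support (finite_support_of_forall_mem_box hn) J)
      hlow x)
  contrapose! hk
  have hbounds (i) : -(L : ℤ) - n ≤ k i ∧ k i ≤ L := by
    have hbox : 0 ≤ x i - k i ∧ x i - k i ≤ n := hn _ (right_ne_zero_of_mul hk) i
    have := mem_cube.1 hx i
    omega
  exact Finset.mem_Icc.2 ⟨fun i => (hbounds i).1, fun i => (hbounds i).2⟩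

theorem sum_Icc_abs_latticeMonomial_le {L : ℕ} (hL : 1 ≤ L) (hI : ∀ i, I i ≤ n) :
    ∑ k ∈ Finset.Icc (fun _ => -(L : ℤ) - n) (fun _ => (L : ℤ)), |latticeMonomial I k| ≤
      2 ^ d * (2 * (L : ℝ) + n) ^ (d * (n + 1)) := by
  have hR : 1 ≤ 2 * (L : ℝ) + n := by exact_mod_cast (by omega : 1 ≤ 2 * L + n)
  have hdeg : ∑ i, I i ≤ d * n := by
    simpa using Finset.sum_le_card_nsmul Finset.univ I n fun i _ => hI i
  have hcard : ((Finset.Icc (fun _ : Fin d => -(L : ℤ) - n) (fun _ => (L : ℤ))).card : ℝ) ≤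
      (2 * (2 * (L : ℝ) + n)) ^ d := by
    have hside : ((L : ℤ) + 1 - (-(L : ℤ) - n)).toNat = 2 * L + n + 1 := by omega
    simp only [Pi.card_Icc, Int.card_Icc, Finset.prod_const, Finset.card_univ, Fintype.card_fin,
      hside]
    push_cast
    gcongr
    linarith
  calc ∑ k ∈ Finset.Icc (fun _ => -(L : ℤ) - n) (fun _ => (L : ℤ)), |latticeMonomial I k|
      ≤ _ := sum_abs_latticeMonomial_le (R := 2 * (L : ℝ) + n) fun k hk i => by
        have hlower : -(L : ℤ) - n ≤ k i := (Finset.mem_Icc.1 hk).1 i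
        have hupper : k i ≤ (L : ℤ) := (Finset.mem_Icc.1 hk).2 i
        exact_mod_cast (abs_le.2 ⟨by omega, by omega⟩ : |k i| ≤ 2 * (L : ℤ) + n)
    _ ≤ (2 * (2 * (L : ℝ) + n)) ^ d * (2 * (L : ℝ) + n) ^ (d * n) := by
        gcongr
    _ = _ := by
        rw [mul_pow]
        ring

variable {μ : Measure ℝ} [IsProbabilityMeasure μ] {ρ : ℝ → ℝ} {lam ε : ℝ}

theorem wegnerBound_of_forall_mem_box (hmom : moment u I ≠ 0) (hlow : ∀ J < I, moment u J = 0)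
    (hn : ∀ k, u k ≠ 0 → ∀ i, 0 ≤ k i ∧ k i ≤ (n : ℤ)) (hI : ∀ i, I i ≤ n)
    (hρ : IsBVDensity μ ρ) (hlam : 0 < lam) {L : ℕ} (hL : 1 ≤ L) (E : ℝ) (hε : 0 < ε) :
    WegnerBound u lam μ L E ε (2 ^ (d + 1) / |moment u I| / lam *
      ((Function.support u).ncard : ℝ) * bvNorm ρ * ε * (2 * (L : ℝ) + n) ^ (d * (n + 1))) := by
  have hfin := finite_support_of_forall_mem_box hn
  have habs : |(-1) ^ (∑ i, I i) * moment u I| = |moment u I| := by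
    rw [abs_mul, abs_neg_one_pow, one_mul]
  have hcard (k) : ((cube d L).filter fun x => u (x - k) ≠ 0).card ≤
      (Function.support u).ncard := by
    have := card_filter_apply_sub_le_encard u (cube d L) k
    rw [← hfin.cast_ncard_eq] at this
    exact_mod_cast this
  have hbound := wegnerBound_of_abs_sum_sub_le hρ (.of_finite_support hfin) hlam
    (abs_ne_zero.1 (habs ▸ abs_ne_zero.2 hmom)) (fun x hx => by
      rw [sum_Icc_latticeMonomial_mul_apply_sub hlow hn hx, sub_self, abs_zero]
      positivity) (fun k _ => hcard k) E hε
  rw [habs] at hbound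
  refine hbound.mono ?_
  calc _ ≤ 2 * ε / (lam * |moment u I|) * (2 ^ d * (2 * (L : ℝ) + n) ^ (d * (n + 1))) *
        ((Function.support u).ncard : ℝ) * bvNorm ρ := by
        have := bvNorm_nonneg ρ
        gcongr
        exact sum_Icc_abs_latticeMonomial_le hL hI
    _ = _ := by
        field_simp
        ring

theorem exists_wegner_constant_of_forall_mem_box (hu : u ≠ 0) :
    ∃ c : ℝ, 0 < c ∧
      ∀ n : ℕ, (∀ k, u k ≠ 0 → ∀ i, 0 ≤ k i ∧ k i ≤ (n : ℤ)) →
      ∀ (μ : Measure ℝ) [IsProbabilityMeasure μ] (ρ : ℝ → ℝ), IsBVDensity μ ρ →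
      ∀ lam : ℝ, 0 < lam → ∀ L : ℕ, 1 ≤ L → ∀ E ε : ℝ, 0 < ε →
        WegnerBound u lam μ L E ε
          (c / lam * ((Function.support u).ncard : ℝ) * bvNorm ρ * ε *
            (2 * (L : ℝ) + n) ^ (d * (n + 1))) := by
  classical
  by_cases hbox : ∃ n : ℕ, ∀ k, u k ≠ 0 → ∀ i, 0 ≤ k i ∧ k i ≤ (n : ℤ)
  · obtain ⟨I, hI, hmom⟩ := exists_moment_ne_zero_of_forall_mem_box hu (Nat.find_spec hbox)
    obtain ⟨J, hJI, hmomJ, hlow⟩ := exists_minimal_moment_ne_zero hmom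
    refine ⟨2 ^ (d + 1) / |moment u J|, by positivity, ?_⟩
    intro n hn μ _ ρ hρ lam hlam L hL E ε hε
    have hJn (i) : J i ≤ n := (hJI i).trans ((hI i).trans (Nat.find_min' hbox hn))
    exact wegnerBound_of_forall_mem_box hmomJ hlow hn hJn hρ hlam hL E hε
  · exact ⟨1, one_pos, fun n hn => absurd ⟨n, hn⟩ hbox⟩

end FiniteSupport

section MomentProblem

open ProbabilityTheory Topology

theorem Ioo_subset_interior_integrableExpSet {Ω : Type*} [MeasurableSpace Ω] {P : Measure Ω}
    {X : Ω → ℝ} {c : ℝ} (h : ∀ t, |t| < c → Integrable (fun ω => Real.exp (t * X ω)) P) :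
    Set.Ioo (-c) c ⊆ interior (integrableExpSet X P) :=
  interior_maximal (fun t ht => h t (abs_lt.2 ht)) isOpen_Ioo

theorem charFun_map_eq_of_integral_pow_eq {Ω : Type*} [MeasurableSpace Ω] {P Q : Measure Ω}
    {X : Ω → ℝ} (hP : AEMeasurable X P) (hQ : AEMeasurable X Q)
    {c : ℝ} (hc : 0 < c) (hPexp : ∀ t, |t| < c → Integrable (fun ω => Real.exp (t * X ω)) P)
    (hQexp : ∀ t, |t| < c → Integrable (fun ω => Real.exp (t * X ω)) Q)
    (hpow : ∀ n : ℕ, ∫ ω, X ω ^ n ∂P = ∫ ω, X ω ^ n ∂Q) :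
    charFun (P.map X) = charFun (Q.map X) := by
  let strip : Set ℂ := {z | z.re ∈ Set.Ioo (-c) c}
  have hanalytic {ν : Measure Ω} (hν : ∀ t, |t| < c → Integrable (fun ω => Real.exp (t * X ω)) ν) :
      AnalyticOnNhd ℂ (complexMGF X ν) strip :=
    analyticOnNhd_complexMGF.mono fun _ hz => Ioo_subset_interior_integrableExpSet hν hz
  have hzero : (0 : ℂ) ∈ strip := by simp [strip, hc]
  have htaylor {ν : Measure Ω} (hν : ∀ t, |t| < c → Integrable (fun ω => Real.exp (t * X ω)) ν)
      (n : ℕ) : iteratedDeriv n (complexMGF X ν) 0 = ((∫ ω, X ω ^ n ∂ν : ℝ) : ℂ) := by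
    rw [iteratedDeriv_complexMGF (Ioo_subset_interior_integrableExpSet hν hzero),
      ← integral_complex_ofReal]
    simp
  have hlocal : complexMGF X P =ᶠ[𝓝 0] complexMGF X Q := by
    have hseriesP := (hanalytic hPexp 0 hzero).hasFPowerSeriesAt
    have hseriesQ := (hanalytic hQexp 0 hzero).hasFPowerSeriesAt
    simp only [htaylor hPexp, hpow] at hseriesP
    simp only [htaylor hQexp] at hseriesQ
    have hdiff := hseriesP.sub hseriesQ
    rw [sub_self] at hdiff
    exact hdiff.eventually_eq_zero.mono fun z hz => sub_eq_zero.1 hz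
  have hconn : IsPreconnected strip :=
    ((convex_Ioo (-c) c).linear_preimage Complex.reLm).isPreconnected
  ext t
  rw [← complexMGF_mul_I hP, ← complexMGF_mul_I hQ]
  exact (hanalytic hPexp).eqOn_of_preconnected_of_eventuallyEq (hanalytic hQexp) hconn hzero
    hlocal (by simp [strip, hc])

theorem measure_ext_of_integral_dual_pow_eq {E : Type*} [NormedAddCommGroup E] [NormedSpace ℝ E]
    [CompleteSpace E] [SecondCountableTopology E] [MeasurableSpace E] [BorelSpace E]
    {P Q : Measure E} [IsFiniteMeasure P] [IsFiniteMeasure Q] {c : ℝ} (hc : 0 < c)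
    (hPexp : Integrable (fun x => Real.exp (c * ‖x‖)) P)
    (hQexp : Integrable (fun x => Real.exp (c * ‖x‖)) Q)
    (hpow : ∀ (φ : StrongDual ℝ E) (n : ℕ), ∫ x, φ x ^ n ∂P = ∫ x, φ x ^ n ∂Q) : P = Q := by
  refine Measure.ext_of_charFunDual (funext fun φ => ?_)
  have hexp {ν : Measure E} (hν : Integrable (fun x => Real.exp (c * ‖x‖)) ν) (t : ℝ)
      (ht : |t| < c / (‖φ‖ + 1)) : Integrable (fun x => Real.exp (t * φ x)) ν := by
    refine hν.mono (by fun_prop) (.of_forall fun x => ?_)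
    rw [Real.norm_eq_abs, Real.norm_eq_abs, Real.abs_exp, Real.abs_exp, Real.exp_le_exp]
    rw [lt_div_iff₀ (by positivity)] at ht
    calc t * φ x ≤ |t| * ‖φ x‖ := (le_abs_self _).trans_eq (abs_mul _ _)
      _ ≤ |t| * ((‖φ‖ + 1) * ‖x‖) := by
        gcongr
        exact (φ.le_opNorm x).trans (by gcongr; linarith)
      _ = |t| * (‖φ‖ + 1) * ‖x‖ := by ring
      _ ≤ c * ‖x‖ := by gcongr
  rw [charFunDual_eq_charFun_map_one, charFunDual_eq_charFun_map_one,
    charFun_map_eq_of_integral_pow_eq (by fun_prop) (by fun_prop)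
      (by positivity : 0 < c / (‖φ‖ + 1)) (hexp hPexp) (hexp hQexp) (hpow φ)]

end MomentProblem

section WeightMeasure

variable {β : Type*} {f w : β → ℝ}

theorem summable_mul_max_zero (hf : Summable fun k => f k * w k) :
    Summable fun k => f k * max (w k) 0 := by
  refine hf.abs.of_norm_bounded fun k => ?_
  rw [Real.norm_eq_abs, abs_mul, abs_mul, abs_of_nonneg (le_max_right (w k) 0)]
  gcongr
  exact max_le (le_abs_self _) (abs_nonneg _)

variable [MeasurableSpace β] [MeasurableSingletonClass β]

/-- The positive part of a real weight `w`, as a measure: the mass of `{k}` is `max (w k) 0`. Thus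
`w` is represented by the pair of measures `weightMeasure w` and `weightMeasure (-w)`. -/
def weightMeasure (w : β → ℝ) : Measure β :=
  Measure.count.withDensity fun k => ENNReal.ofReal (w k)

theorem weightMeasure_singleton (w : β → ℝ) (k : β) :
    weightMeasure w {k} = ENNReal.ofReal (w k) := by
  rw [weightMeasure, withDensity_apply _ (measurableSet_singleton k), Measure.restrict_singleton]
  simp

theorem eq_zero_of_weightMeasure_eq (h : weightMeasure w = weightMeasure (-w)) : w = 0 := by
  ext k
  have hmass : max (w k) 0 = max (-w k) 0 := by
    simpa only [weightMeasure_singleton, ENNReal.toReal_ofReal', Pi.neg_apply] using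
      congrArg (fun P => (P {k}).toReal) h
  rw [← max_zero_sub_max_neg_zero_eq_self (w k), hmass, sub_self, Pi.zero_apply]

variable [Countable β]

theorem integrable_weightMeasure (hf : Summable fun k => f k * w k) :
    Integrable f (weightMeasure w) := by
  refine (integrable_withDensity_iff_integrable_smul (f := fun k => (w k).toNNReal)
    (measurable_of_countable _)).2 (integrable_count_iff.2 ?_)
  simpa only [NNReal.smul_def, Real.coe_toNNReal', smul_eq_mul, mul_comm] using
    (summable_mul_max_zero hf).norm

theorem integral_weightMeasure (hf : Summable fun k => f k * w k) :
    ∫ k, f k ∂weightMeasure w = ∑' k, f k * max (w k) 0 := by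
  rw [integral_countable (integrable_weightMeasure hf)]
  refine tsum_congr fun k => ?_
  rw [Measure.real, weightMeasure_singleton, ENNReal.toReal_ofReal', smul_eq_mul, mul_comm]

theorem integral_weightMeasure_sub (hf : Summable fun k => f k * w k) :
    ∫ k, f k ∂weightMeasure w - ∫ k, f k ∂weightMeasure (-w) = ∑' k, f k * w k := by
  have hneg : Summable fun k => f k * (-w) k := by simpa using hf.neg
  rw [integral_weightMeasure hf, integral_weightMeasure hneg,
    ← (summable_mul_max_zero hf).tsum_sub (summable_mul_max_zero hneg)]
  refine tsum_congr fun k => ?_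
  rw [← mul_sub, Pi.neg_apply, max_zero_sub_max_neg_zero_eq_self]

theorem isFiniteMeasure_weightMeasure (hw : Summable w) : IsFiniteMeasure (weightMeasure w) :=
  (integrable_const_iff_isFiniteMeasure one_ne_zero).1
    (integrable_weightMeasure (f := fun _ => (1 : ℝ)) (by simpa using hw))

end WeightMeasure

section ExponentialMoments

theorem l1norm_nonneg (k : Fin d → ℤ) : 0 ≤ l1norm k :=
  Finset.sum_nonneg fun _ _ => abs_nonneg _

theorem cast_l1norm (k : Fin d → ℤ) : (l1norm k : ℝ) = ∑ i, |(k i : ℝ)| := by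
  simp [l1norm]

theorem cast_l1norm_nonneg (k : Fin d → ℤ) : (0 : ℝ) ≤ l1norm k :=
  mod_cast l1norm_nonneg k

theorem abs_apply_le_l1norm (k : Fin d → ℤ) (i : Fin d) : |k i| ≤ l1norm k :=
  Finset.single_le_sum (f := fun i => |k i|) (fun _ _ => abs_nonneg _) (Finset.mem_univ i)

theorem summable_prod_apply {α : Type*} {f : α → ℝ} (hf : Summable f) (hf0 : ∀ j, 0 ≤ f j)
    (d : ℕ) : Summable fun k : Fin d → α => ∏ i, f (k i) := by
  induction d with
  | zero => exact summable_of_hasFiniteSupport (Set.toFinite _)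
  | succ d ih =>
    rw [← (Fin.consEquiv fun _ : Fin (d + 1) => α).summable_iff]
    refine (hf.mul_of_nonneg ih hf0 fun k => Finset.prod_nonneg fun i _ => hf0 _).congr
      fun p => ?_
    simp [Fin.consEquiv, Fin.prod_univ_succ]

theorem summable_exp_neg_mul_l1norm (d : ℕ) {β : ℝ} (hβ : 0 < β) :
    Summable fun k : Fin d → ℤ => Real.exp (-β * (l1norm k : ℝ)) := by
  have hnat : Summable fun n : ℕ => Real.exp (n * (-β)) :=
    Real.summable_exp_nat_mul_iff.2 (neg_lt_zero.2 hβ)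
  have hint : Summable fun j : ℤ => Real.exp (-β * |(j : ℝ)|) := by
    refine Summable.of_nat_of_neg (hnat.congr fun n => ?_) (hnat.congr fun n => ?_) <;>
    simp [mul_comm]
  refine (summable_prod_apply hint (fun _ => (Real.exp_pos _).le) d).congr fun k => ?_
  rw [← Real.exp_sum, ← Finset.mul_sum, cast_l1norm]

variable {u : (Fin d → ℤ) → ℝ}

theorem summable_exp_mul_l1norm_mul {C α t : ℝ}
    (hu : ∀ k, |u k| ≤ C * Real.exp (-α * (l1norm k : ℝ))) (ht : t < α) :
    Summable fun k => Real.exp (t * (l1norm k : ℝ)) * u k := by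
  refine ((summable_exp_neg_mul_l1norm d (sub_pos.2 ht)).mul_left C).of_norm_bounded fun k => ?_
  calc ‖Real.exp (t * (l1norm k : ℝ)) * u k‖
      = Real.exp (t * (l1norm k : ℝ)) * |u k| := by
        rw [Real.norm_eq_abs, abs_mul, Real.abs_exp]
    _ ≤ Real.exp (t * (l1norm k : ℝ)) * (C * Real.exp (-α * (l1norm k : ℝ))) := by
        gcongr
        exact hu k
    _ = C * Real.exp (-(α - t) * (l1norm k : ℝ)) := by
        rw [mul_left_comm, ← Real.exp_add]
        ring_nf

variable {t : ℝ} (ht : 0 < t) (hexp : Summable fun k => Real.exp (t * (l1norm k : ℝ)) * u k)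

include ht hexp

theorem summable_l1norm_pow_mul_abs (p : ℕ) : Summable fun k => (l1norm k : ℝ) ^ p * |u k| := by
  refine (hexp.abs.mul_left (p.factorial / t ^ p)).of_nonneg_of_le (fun k => ?_) fun k => ?_
  · exact mul_nonneg (pow_nonneg (cast_l1norm_nonneg k) p) (abs_nonneg _)
  · have hpow : (l1norm k : ℝ) ^ p ≤ p.factorial / t ^ p * Real.exp (t * l1norm k) := by
      have h := Real.pow_div_factorial_le_exp (t * l1norm k)
        (mul_nonneg ht.le (cast_l1norm_nonneg k)) p
      rw [div_le_iff₀ (by positivity), mul_pow] at h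
      rw [div_mul_eq_mul_div, le_div_iff₀ (by positivity)]
      linarith
    rw [abs_mul, Real.abs_exp, ← mul_assoc]
    gcongr

theorem summable_latticeMonomial_mul (I : Fin d → ℕ) :
    Summable fun k => latticeMonomial I k * u k := by
  refine (summable_l1norm_pow_mul_abs ht hexp (∑ i, I i)).of_norm_bounded fun k => ?_
  rw [Real.norm_eq_abs, abs_mul]
  gcongr
  exact abs_latticeMonomial_le fun i => mod_cast abs_apply_le_l1norm k i

theorem hasSum_sum_mul_pow_mul (ξ : Fin d → ℝ) (n : ℕ) :
    HasSum (fun k => (∑ i, (k i : ℝ) * ξ i) ^ n * u k)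
      (∑ J ∈ Finset.univ.piAntidiag n,
        ((Nat.multinomial Finset.univ J : ℝ) * ∏ i, ξ i ^ J i) * moment u J) := by
  have hexpand (k : Fin d → ℤ) : (∑ i, (k i : ℝ) * ξ i) ^ n * u k =
      ∑ J ∈ Finset.univ.piAntidiag n,
        ((Nat.multinomial Finset.univ J : ℝ) * ∏ i, ξ i ^ J i) * (latticeMonomial J k * u k) := by
    rw [Finset.sum_pow_eq_sum_piAntidiag, Finset.sum_mul]
    refine Finset.sum_congr rfl fun J _ => ?_
    simp only [mul_pow, Finset.prod_mul_distrib, latticeMonomial]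
    ring
  simp only [hexpand]
  exact hasSum_sum fun J _ => (summable_latticeMonomial_mul ht hexp J).hasSum.mul_left _

theorem integrable_exp_mul_norm_map_weightMeasure :
    Integrable (fun x => Real.exp (t * ‖x‖))
      ((weightMeasure u).map fun k i => ((k i : ℤ) : ℝ)) := by
  rw [integrable_map_measure (by fun_prop) (measurable_of_countable _).aemeasurable]
  refine integrable_weightMeasure (hexp.abs.of_norm_bounded fun k => ?_)
  rw [Real.norm_eq_abs, abs_mul, abs_mul, Function.comp_apply, Real.abs_exp, Real.abs_exp]
  gcongr
  exact (pi_norm_le_iff_of_nonneg (cast_l1norm_nonneg k)).2 fun i => by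
    rw [Real.norm_eq_abs]
    exact_mod_cast abs_apply_le_l1norm k i

theorem exists_moment_ne_zero_of_summable_exp (hu : u ≠ 0) : ∃ I, moment u I ≠ 0 := by
  by_contra! hzero
  have hexp_neg : Summable fun k => Real.exp (t * (l1norm k : ℝ)) * (-u) k := by
    simpa only [Pi.neg_apply, mul_neg] using hexp.neg
  have hsum : Summable u := by
    simpa only [pow_zero, one_mul, summable_abs_iff] using summable_l1norm_pow_mul_abs ht hexp 0
  have := isFiniteMeasure_weightMeasure hsum
  have := isFiniteMeasure_weightMeasure (w := -u) hsum.neg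
  let ι (k : Fin d → ℤ) (i : Fin d) : ℝ := k i
  have hι : Measurable ι := measurable_of_countable ι
  have hemb : MeasurableEmbedding ι :=
    hι.measurableEmbedding fun k j h => funext fun i => Int.cast_injective (congrFun h i)
  have hmap : (weightMeasure u).map ι = (weightMeasure (-u)).map ι := by
    refine measure_ext_of_integral_dual_pow_eq ht
      (integrable_exp_mul_norm_map_weightMeasure ht hexp)
      (integrable_exp_mul_norm_map_weightMeasure ht hexp_neg) fun φ n => ?_
    have hφ (k : Fin d → ℤ) :
        φ (ι k) = ∑ i, (k i : ℝ) * φ (fun j => if i = j then 1 else 0) :=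
      φ.toLinearMap.pi_apply_eq_sum_univ (ι k)
    have hpow := hasSum_sum_mul_pow_mul ht hexp (fun i => φ fun j => if i = j then 1 else 0) n
    simp only [hzero, mul_zero, Finset.sum_const_zero, ← hφ] at hpow
    rw [hemb.integral_map, hemb.integral_map, ← sub_eq_zero,
      integral_weightMeasure_sub hpow.summable, hpow.tsum_eq]
  refine hu (eq_zero_of_weightMeasure_eq ?_)
  rw [← hemb.comap_map (weightMeasure u), hmap, hemb.comap_map]

end ExponentialMoments

section ExponentialDecay

variable {u : (Fin d → ℤ) → ℝ} {I : Fin d → ℕ} {L s : ℕ} {x k : Fin d → ℤ}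

theorem mul_le_l1norm_sub_of_notMem_cube (hx : x ∈ cube d L) (hk : k ∉ cube d ((1 + s) * L)) :
    ((s * L : ℕ) : ℤ) ≤ l1norm (x - k) := by
  obtain ⟨i, hi⟩ := not_forall.1 (mem_cube.not.1 hk)
  have hxi := mem_cube.1 hx i
  have hle : ((x i - k i).natAbs : ℤ) ≤ l1norm (x - k) := by
    simpa using abs_apply_le_l1norm (x - k) i
  rw [add_mul, one_mul] at hi
  omega

theorem abs_apply_le_two_mul_l1norm_sub (hx : x ∈ cube d L) (hL : (L : ℤ) ≤ l1norm (x - k))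
    (i : Fin d) : |k i| ≤ 2 * l1norm (x - k) := by
  have hxi := mem_cube.1 hx i
  have hle := abs_le.1 (abs_apply_le_l1norm (x - k) i)
  rw [Pi.sub_apply] at hle
  exact abs_le.2 ⟨by omega, by omega⟩

theorem abs_latticeMonomial_mul_apply_sub_le (u : (Fin d → ℤ) → ℝ) (I : Fin d → ℕ) (hs : 1 ≤ s)
    (hL : 1 ≤ L) (hx : x ∈ cube d L) (hk : k ∉ cube d ((1 + s) * L)) :
    |latticeMonomial I k * u (x - k)| ≤ 2 ^ (∑ i, I i) / s *
      ((l1norm (x - k) : ℝ) ^ (∑ i, I i + 1) * |u (x - k)|) := by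
  have hfar := mul_le_l1norm_sub_of_notMem_cube hx hk
  have hLle : (L : ℤ) ≤ l1norm (x - k) := le_trans (mod_cast Nat.le_mul_of_pos_left L hs) hfar
  have hsle : (s : ℝ) ≤ l1norm (x - k) :=
    mod_cast (Int.ofNat_le.2 (Nat.le_mul_of_pos_right s hL)).trans hfar
  have hmon : |latticeMonomial I k| ≤ (2 * (l1norm (x - k) : ℝ)) ^ ∑ i, I i :=
    abs_latticeMonomial_le fun i => mod_cast abs_apply_le_two_mul_l1norm_sub hx hLle i
  have hs0 : (0 : ℝ) < s := mod_cast hs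
  have hr0 := cast_l1norm_nonneg (x - k)
  calc |latticeMonomial I k * u (x - k)|
      ≤ (2 * (l1norm (x - k) : ℝ)) ^ (∑ i, I i) * 1 * |u (x - k)| := by
        rw [abs_mul, mul_one]
        gcongr
    _ ≤ (2 * (l1norm (x - k) : ℝ)) ^ (∑ i, I i) * (l1norm (x - k) / s) * |u (x - k)| := by
        gcongr
        exact (one_le_div hs0).2 hsle
    _ = _ := by ring

theorem abs_sum_cube_latticeMonomial_mul_sub_le
    (hmom : ∀ J ≤ I, Summable fun k => latticeMonomial J k * u k)
    (hdecay : Summable fun k => (l1norm k : ℝ) ^ (∑ i, I i + 1) * |u k|)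
    (hlow : ∀ J < I, moment u J = 0) (hs : 1 ≤ s) (hL : 1 ≤ L) (hx : x ∈ cube d L) :
    |∑ k ∈ cube d ((1 + s) * L), latticeMonomial I k * u (x - k) -
      (-1) ^ (∑ i, I i) * moment u I| ≤
        2 ^ (∑ i, I i) / s * ∑' k, (l1norm k : ℝ) ^ (∑ i, I i + 1) * |u k| :=
  norm_sum_sub_le_of_hasSum (hasSum_latticeMonomial_mul_apply_sub hmom hlow x)
    ((Equiv.subLeft x).hasSum_iff.2 (hdecay.hasSum.mul_left _)) _
    (fun k _ => mul_nonneg (by positivity)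
      (mul_nonneg (pow_nonneg (cast_l1norm_nonneg (x - k)) _) (abs_nonneg _)))
    fun _ hk => abs_latticeMonomial_mul_apply_sub_le u I hs hL hx hk

theorem sum_cube_abs_latticeMonomial_le (I : Fin d → ℕ) (s L : ℕ) :
    ∑ k ∈ cube d ((1 + s) * L), |latticeMonomial I k| ≤
      (1 + s : ℝ) ^ (d + ∑ i, I i) * (2 * (L : ℝ) + 1) ^ (d + ∑ i, I i) := by
  have hcard : ((cube d ((1 + s) * L)).card : ℝ) ≤ ((1 + s) * (2 * (L : ℝ) + 1)) ^ d := by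
    rw [card_cube]
    push_cast
    gcongr
    linarith
  calc ∑ k ∈ cube d ((1 + s) * L), |latticeMonomial I k|
      ≤ (cube d ((1 + s) * L)).card * ((1 + s) * (2 * (L : ℝ) + 1)) ^ ∑ i, I i :=
        sum_abs_latticeMonomial_le fun k hk i => by
          have hki : |(k i : ℝ)| ≤ (1 + s) * L := by
            have := mem_cube.1 hk i
            exact_mod_cast (abs_le.2 ⟨by omega, by omega⟩ : |k i| ≤ (((1 + s) * L : ℕ) : ℤ))
          exact hki.trans (by gcongr; linarith)
    _ ≤ ((1 + s) * (2 * (L : ℝ) + 1)) ^ d * ((1 + s) * (2 * (L : ℝ) + 1)) ^ ∑ i, I i := by gcongr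
    _ = _ := by rw [← pow_add, mul_pow]

variable {μ : Measure ℝ} [IsProbabilityMeasure μ] {ρ : ℝ → ℝ} {lam ε : ℝ}

theorem wegnerBound_of_minimal_moment_ne_zero (hI : moment u I ≠ 0)
    (hlow : ∀ J < I, moment u J = 0)
    (hmom : ∀ J ≤ I, Summable fun k => latticeMonomial J k * u k)
    (hdecay : Summable fun k => (l1norm k : ℝ) ^ (∑ i, I i + 1) * |u k|) (hs : 1 ≤ s)
    (hsmall : 2 ^ (∑ i, I i) / s * ∑' k, (l1norm k : ℝ) ^ (∑ i, I i + 1) * |u k| ≤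
      |moment u I| / 2)
    (hρ : IsBVDensity μ ρ) (hconv : PotentialConverges u μ) (hlam : 0 < lam) (hL : 1 ≤ L) (E : ℝ)
    (hε : 0 < ε) :
    WegnerBound u lam μ L E ε (2 * (1 + s : ℝ) ^ (d + ∑ i, I i) / |moment u I| / lam *
      bvNorm ρ * ε * (2 * (L : ℝ) + 1) ^ (2 * d + ∑ i, I i)) := by
  have habs : |(-1) ^ (∑ i, I i) * moment u I| = |moment u I| := by
    rw [abs_mul, abs_neg_one_pow, one_mul]
  have hcard (k) : ((cube d L).filter fun x => u (x - k) ≠ 0).card ≤ (2 * L + 1) ^ d :=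
    (Finset.card_filter_le _ _).trans_eq (card_cube d L)
  have hbound := wegnerBound_of_abs_sum_sub_le hρ hconv hlam
    (abs_ne_zero.1 (habs ▸ abs_ne_zero.2 hI)) (fun x hx => habs ▸
      (abs_sum_cube_latticeMonomial_mul_sub_le hmom hdecay hlow hs hL hx).trans hsmall)
    (fun k _ => hcard k) E hε
  rw [habs] at hbound
  refine hbound.mono ?_
  calc _ ≤ 2 * ε / (lam * |moment u I|) *
        ((1 + s : ℝ) ^ (d + ∑ i, I i) * (2 * (L : ℝ) + 1) ^ (d + ∑ i, I i)) *
        (((2 * L + 1) ^ d : ℕ) : ℝ) * bvNorm ρ := by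
        have := bvNorm_nonneg ρ
        gcongr
        exact sum_cube_abs_latticeMonomial_le I s L
    _ = _ := by
        push_cast
        field_simp
        ring

theorem exists_wegner_constant_of_exp_decay (hu0 : u ≠ 0) {C α : ℝ} (hα : 0 < α)
    (hu : ∀ k, |u k| ≤ C * Real.exp (-α * (l1norm k : ℝ))) :
    ∃ (c : ℝ) (I₀ : Fin d → ℕ), 0 < c ∧
      ∀ (μ : Measure ℝ) [IsProbabilityMeasure μ] (ρ : ℝ → ℝ), IsBVDensity μ ρ →
      PotentialConverges u μ →
      ∀ lam : ℝ, 0 < lam → ∀ L : ℕ, 1 ≤ L → ∀ E ε : ℝ, 0 < ε →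
        WegnerBound u lam μ L E ε
          (c / lam * bvNorm ρ * ε * (2 * (L : ℝ) + 1) ^ (2 * d + ∑ i, I₀ i)) := by
  have hexp := summable_exp_mul_l1norm_mul hu (half_lt_self hα)
  obtain ⟨I, hI⟩ := exists_moment_ne_zero_of_summable_exp (half_pos hα) hexp hu0
  obtain ⟨J, -, hJ, hlow⟩ := exists_minimal_moment_ne_zero hI
  have hlim := (tendsto_const_div_atTop_nhds_zero_nat ((2 : ℝ) ^ ∑ i, J i)).mul_const
    (∑' k, (l1norm k : ℝ) ^ (∑ i, J i + 1) * |u k|)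
  rw [zero_mul] at hlim
  obtain ⟨s, hsmall, hs⟩ := ((hlim.eventually_le_const (half_pos (abs_pos.2 hJ))).and
    (Filter.eventually_ge_atTop 1)).exists
  refine ⟨2 * (1 + s : ℝ) ^ (d + ∑ i, J i) / |moment u J|, J, by positivity, ?_⟩
  intro μ _ ρ hρ hconv lam hlam L hL E ε hε
  exact wegnerBound_of_minimal_moment_ne_zero hJ hlow
    (fun K _ => summable_latticeMonomial_mul (half_pos hα) hexp K)
    (summable_l1norm_pow_mul_abs (half_pos hα) hexp _) hs hsmall hρ hconv hlam hL E hε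

end ExponentialDecay

end AlloyType

end

theorem mainTheorem6_general (d : ℕ) (u : (Fin d → ℤ) → ℝ) (hu0 : u ≠ 0) :
    (∃ c : ℝ, 0 < c ∧
      ∀ n : ℕ, (∀ k, u k ≠ 0 → ∀ i, 0 ≤ k i ∧ k i ≤ (n : ℤ)) →
      ∀ (μ : Measure ℝ) [IsProbabilityMeasure μ] (ρ : ℝ → ℝ), AlloyType.IsBVDensity μ ρ →
      ∀ lam : ℝ, 0 < lam → ∀ L : ℕ, 1 ≤ L → ∀ E ε : ℝ, 0 < ε →
        AlloyType.WegnerBound u lam μ L E ε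
          (c / lam * ((Function.support u).ncard : ℝ) * AlloyType.bvNorm ρ * ε *
            (2 * (L : ℝ) + n) ^ (d * (n + 1)))) ∧
    ((∑' k, u k) ≠ 0 →
      ∀ (μ : Measure ℝ) [IsProbabilityMeasure μ] (ρ : ℝ → ℝ), AlloyType.IsBVDensity μ ρ →
      AlloyType.PotentialConverges u μ →
      ∀ m : ℕ,
        (∑' k : {k : Fin d → ℤ | (m : ℤ) ≤ AlloyType.l1norm k}, |u k|) ≤ |(∑' k, u k) / 2| →
      ∀ lam : ℝ, 0 < lam → ∀ (L : ℕ) (E ε : ℝ), 0 < ε →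
        AlloyType.WegnerBound u lam μ L E ε
          (4 / (lam * |∑' k, u k|) * (AlloyType.minSupp u ((2 * L + 1) ^ d) : ℝ) *
            AlloyType.bvNorm ρ * ε * (2 * (L : ℝ) + m) ^ d) ∧
        (d ≤ L → AlloyType.WegnerBound u lam μ L E ε
          (8 / (lam * |∑' k, u k|) * (AlloyType.minSupp u ((2 * L) ^ d) : ℝ) *
            AlloyType.bvNorm ρ * ε * (2 * (L : ℝ) + m) ^ d))) ∧
    (∀ C α : ℝ, 0 < α →
      (∀ k, |u k| ≤ C * Real.exp (-α * (AlloyType.l1norm k : ℝ))) →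
      ∃ (c : ℝ) (I₀ : Fin d → ℕ), 0 < c ∧
      ∀ (μ : Measure ℝ) [IsProbabilityMeasure μ] (ρ : ℝ → ℝ), AlloyType.IsBVDensity μ ρ →
      AlloyType.PotentialConverges u μ →
      ∀ lam : ℝ, 0 < lam → ∀ L : ℕ, 1 ≤ L → ∀ E ε : ℝ, 0 < ε →
        AlloyType.WegnerBound u lam μ L E ε
          (c / lam * AlloyType.bvNorm ρ * ε *
            (2 * (L : ℝ) + 1) ^ (2 * d + ∑ i, I₀ i))) :=
  ⟨AlloyType.exists_wegner_constant_of_forall_mem_box hu0,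
    fun hmean _ _ _ hρ hconv _ hm _ hlam L E _ hε =>
      ⟨AlloyType.wegnerBound_of_tsum_ne_zero hmean hρ hconv hm hlam L E hε,
        fun hL => AlloyType.wegnerBound_of_tsum_ne_zero_of_le hmean hρ hconv hm hlam hL E hε⟩,
    fun _ _ hα hdecay => AlloyType.exists_wegner_constant_of_exp_decay hu0 hα hdecay⟩

theorem mainTheorem6 (d : ℕ) (hd : 1 ≤ d) (u : (Fin d → ℤ) → ℝ) (hu : Summable u)
    (hu0 : u ≠ 0) :
    -- part (a)
    (∃ c : ℝ, 0 < c ∧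
      ∀ n : ℕ, (∀ k, u k ≠ 0 → ∀ i, 0 ≤ k i ∧ k i ≤ (n : ℤ)) →
      ∀ (μ : Measure ℝ) [IsProbabilityMeasure μ] (ρ : ℝ → ℝ), AlloyType.IsBVDensity μ ρ →
      ∀ lam : ℝ, 0 < lam → ∀ L : ℕ, 1 ≤ L → ∀ E ε : ℝ, 0 < ε →
        AlloyType.WegnerBound u lam μ L E ε
          (c / lam * ((Function.support u).ncard : ℝ) * AlloyType.bvNorm ρ * ε *
            (2 * (L : ℝ) + n) ^ (d * (n + 1)))) ∧
    -- part (b)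
    ((∑' k, u k) ≠ 0 →
      ∀ (μ : Measure ℝ) [IsProbabilityMeasure μ] (ρ : ℝ → ℝ), AlloyType.IsBVDensity μ ρ →
      HasCompactSupport ρ →
      ∀ m : ℕ,
        (∑' k : {k : Fin d → ℤ | (m : ℤ) ≤ AlloyType.l1norm k}, |u k|) ≤ |(∑' k, u k) / 2| →
      ∀ lam : ℝ, 0 < lam → ∀ L : ℕ, 1 ≤ L → ∀ E ε : ℝ, 0 < ε →
        AlloyType.WegnerBound u lam μ L E ε
          (8 / (lam * |∑' k, u k|) * (AlloyType.minSupp u ((2 * L + 1) ^ d) : ℝ) *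
            AlloyType.bvNorm ρ * ε * (2 * (L : ℝ) + m) ^ d) ∧
        (d ≤ L → AlloyType.WegnerBound u lam μ L E ε
          (8 / (lam * |∑' k, u k|) * (AlloyType.minSupp u ((2 * L) ^ d) : ℝ) *
            AlloyType.bvNorm ρ * ε * (2 * (L : ℝ) + m) ^ d))) ∧
    -- part (c)
    ((∃ C α : ℝ, 0 < C ∧ 0 < α ∧
        ∀ k, |u k| ≤ C * Real.exp (-α * (AlloyType.l1norm k : ℝ))) →
      ∃ (c : ℝ) (I₀ : Fin d → ℕ), 0 < c ∧
      ∀ (μ : Measure ℝ) [IsProbabilityMeasure μ] (ρ : ℝ → ℝ), AlloyType.IsBVDensity μ ρ →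
      Bornology.IsBounded (Function.support ρ) →
      ∀ lam : ℝ, 0 < lam → ∀ L : ℕ, 1 ≤ L → ∀ E ε : ℝ, 0 < ε →
        AlloyType.WegnerBound u lam μ L E ε
          (c / lam * AlloyType.bvNorm ρ * ε *
            (2 * (L : ℝ) + 1) ^ (2 * d + ∑ i, I₀ i))) := by
  obtain ⟨finite, mean, decay⟩ := mainTheorem6_general d u hu0
  refine ⟨finite, fun hmean μ _ ρ hρ hsupp m hm lam hlam L _ E ε hε => ?_,
    fun ⟨C, α, _, hα, hdecay⟩ => ?_⟩
  · have hbdd := hsupp.isCompact.isBounded.subset (subset_tsupport ρ)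
    obtain ⟨hfull, hhalf⟩ :=
      mean hmean μ ρ hρ (.of_isBounded_support hu hρ hbdd) m hm lam hlam L E ε hε
    refine ⟨hfull.mono ?_, hhalf⟩
    have := AlloyType.bvNorm_nonneg ρ
    gcongr
    norm_num
  · obtain ⟨c, I₀, hc, hbound⟩ := decay C α hα hdecay
    exact ⟨c, I₀, hc, fun μ _ ρ hρ hbdd => hbound μ ρ hρ (.of_isBounded_support hu hρ hbdd)⟩
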